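/- **Setting.** Let $(Z,\mathfrak Z,\nu)$ be a $\sigma$-finite measure space and let $\eta$ be a Poisson point process on $Z$ with intensity $\nu$, defined on a probability space $(\Omega,\mathfrak O,\mathbb P)$; let $\mathfrak W=\sigma(\eta)$. A real functional of $\eta$ is a random variable $F=f(\eta)$ with $f$ measurable, and $D_z^+F=f(\eta+\delta_z)-f(\eta)$. Write $F\in\operatorname{dom}D$ if $\mathbb E F^2+\mathbb E\int (D_z^+F)^2\,\nu(\mathrm dz)<\infty$, and then $DF=(D^+_zF)_{z\in Z}$. The divergence $\delta$ is the adjoint of $D$: $u=u(\eta,z)\in L^2(\mathbb P\otimes\nu)$ belongs to $\operatorname{dom}\delta$ if there is $c$ with $|\mathbb E\int u(z)D_z^+G\,\nu(\mathrm dz)|\le c\,(\mathbb E G^2)^{1/2}$ for all $G\in\operatorname{dom}D$, and $\delta u\in L^2(\Omega,\mathfrak W,\mathbb P)$ is then determined by $\mathbb E[G\,\delta u]=\mathbb E\int u(z)D_z^+G\,\nu(\mathrm dz)$ for all $G\in\operatorname{dom}D$. For vector- or matrix-valued objects all this is understood coordinatewise. Put $[u,v]_\nu=\int u(z)\otimes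 v(z)\,\nu(\mathrm dz)$, let $\widetilde{A}=\frac12(A+A^T)$ be the symmetrization of a matrix $A$, and let $|\cdot|$ be the $\ell^2$ norm of vectors, matrices and tensors. A sequence $(X_n)$ of $\mathfrak W$-measurable random elements converges stably to $X$, defined on $\Omega$ or on an extension of it, if $(X_n,Y)\to(X,Y)$ in law for every bounded $\mathfrak W$-measurable $Y$. **Theorem.** Let $F_n\in\operatorname{dom}D$ ($n\in\mathbb N$) be $\mathbb R^d$-valued, and let $u_n\in\operatorname{dom}\delta$ be such that $F_n=\delta u_n$. Let $S\in L^2(\Omega,\mathfrak O,\mathbb P)$ be a random $d\times d$ matrix, not necessarily $\mathfrak W$-measurable. Let $S_n$ be $\mathfrak W$-measurable random $d\times d$ matrices with $S_n\in\operatorname{dom}D$ for $n$ large, such that, for $n$ large, $$\widetilde{[u_n,DF_n]}_\nu=C_n+\epsilon_n,\qquad C_n=S_nS_n^T .$$ Assume that, as $n\to\infty$, - (W$_\nu$) $[u_n,h]_\nu\to0$ in $L^1(\mathbb P)$ for all $h\in L^2(\nu;\mathbb R^d)$; - (R$_3$) $\mathbb E\int|u_n(z)|\,|D_z^+F_n|^2\,\nu(\mathrm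 dz)\to0$; - (C.st) $C_n\to SS^T$ stably; - ($\epsilon$) $\epsilon_n\to0$ in $L^1(\mathbb P)$; - (RS) $[u_n,(DS_n)S_n^T]_\nu\to0$ in $L^1(\mathbb P)$; - (Rh) $\int|h(z)|\,|D_z^+F_n|^2\,\nu(\mathrm dz)\to0$ in $L^1(\mathbb P)$ for all $h\in L^2(\nu;\mathbb R^d)$; - (S$_3$) $\int|u_n(z)|\,|D_z^+S_n|^2\,\nu(\mathrm dz)\to0$ in $L^1(\mathbb P)$; - (Sh) $\int|h(z)|\,|D_z^+S_n|^2\,\nu(\mathrm dz)\to0$ in $L^1(\mathbb P)$ for all $h\in L^2(\nu;\mathbb R^d)$. Then $F_n$ converges stably to the Gaussian mixture $\mathbf N(0,S^2)$, that is, to $SN$, where $N$ is a standard Gaussian vector of $\mathbb R^d$ independent of $(\eta,S)$ (defined on an extension of $\Omega$). -/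

import Mathlib

open MeasureTheory ProbabilityTheory Filter Topology
open scoped ENNReal

noncomputable section

namespace PoissonSpace

/-- The Euclidean space `ℝ^d` with its `ℓ²` norm. -/
abbrev Vec (d : ℕ) : Type := EuclideanSpace ℝ (Fin d)

/-- Real square matrices of size `d`. -/
abbrev Mat (d : ℕ) : Type := Matrix (Fin d) (Fin d) ℝ

/-- The `ℓ²` norm of a finite family of reals; applied to the family of all coordinates, it is the
`ℓ²` norm of a tensor. -/
def ellTwo {ι : Type*} [Fintype ι] (x : ι → ℝ) : ℝ := √(∑ i, x i ^ 2)

/-- The `ℓ²` (Frobenius) norm of a matrix. -/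
def matNorm {d : ℕ} (A : Mat d) : ℝ := ellTwo fun p : Fin d × Fin d => A p.1 p.2

section PointConfig

variable {Ω Z : Type*} [MeasurableSpace Ω] [MeasurableSpace Z]

/-- The measure `m` takes only (finite) natural number values. -/
def IsNatValued (m : Measure Z) : Prop :=
  ∀ B, MeasurableSet B → ∃ k : ℕ, m B = (k : ℝ≥0∞)

/-- The measure `ξ` is a countable sum of `ℕ`-valued measures. -/
def IsCountingSum (ξ : Measure Z) : Prop :=
  ∃ m : ℕ → Measure Z, (∀ k, IsNatValued (m k)) ∧ ξ = Measure.sum m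

/-- `η` is a Poisson point process with intensity `ν`. The `σ`-algebra on `Measure Z` is the one
generated by the evaluations `ξ ↦ ξ B`, with `B` measurable. -/
structure IsPoissonProcess (η : Ω → Measure Z) (ν : Measure Z) (P : Measure Ω) : Prop where
  measurable : Measurable η
  counting : ∀ ω, IsCountingSum (η ω)
  indep : ∀ (n : ℕ) (B : Fin n → Set Z), (∀ i, MeasurableSet (B i)) →
    Pairwise (fun i j => Disjoint (B i) (B j)) → iIndepFun (fun i ω => η ω (B i)) P
  law : ∀ B, MeasurableSet B → ν B < ∞ →
    P.map (fun ω => η ω B) =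
      (poissonMeasure (ν B).toNNReal).map (fun k : ℕ => (k : ℝ≥0∞))

/-- The `σ`-algebra on `Ω` generated by `η`. -/
abbrev sigmaAlg (η : Ω → Measure Z) : MeasurableSpace Ω :=
  MeasurableSpace.comap η inferInstance

/-- The add operator `D⁺_z F = f(η + δ_z) - f(η)`, where `F = f(η)`. A functional `F` of the point
process is given by a representative `f`, and `addOp f ξ z` is the value of `D⁺_z F` on `η = ξ`. -/
def addOp {E : Type*} [Sub E] (f : Measure Z → E) (ξ : Measure Z) (z : Z) : E :=
  f (ξ + Measure.dirac z) - f ξ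

/-- The real functional `f(η)` belongs to `dom D`: it is square integrable and
`E ∫ |D⁺_z f(η)|² ν(dz) < ∞`. -/
structure MemDomD (η : Ω → Measure Z) (ν : Measure Z) (P : Measure Ω) (f : Measure Z → ℝ) :
    Prop where
  measurable : Measurable f
  memLp : MemLp (fun ω => f (η ω)) 2 P
  deriv : ∫⁻ ω, ∫⁻ z, ‖addOp f (η ω) z‖ₑ ^ 2 ∂ν ∂P < ∞

/-- The real random function `z ↦ u(η, z)` belongs to `dom δ`, the domain of the adjoint of `D`. -/
structure MemDomDelta (η : Ω → Measure Z) (ν : Measure Z) (P : Measure Ω)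
    (u : Measure Z → Z → ℝ) : Prop where
  measurable : Measurable (Function.uncurry u)
  memLp : MemLp (fun p : Ω × Z => u (η p.1) p.2) 2 (P.prod ν)
  bound : ∃ c : ℝ, ∀ G, MemDomD η ν P G →
    |∫ ω, ∫ z, addOp G (η ω) z * u (η ω) z ∂ν ∂P| ≤ c * √(∫ ω, G (η ω) ^ 2 ∂P)

/-- `u ∈ dom δ` and `δ u = f(η)`: the graph of the adjoint `δ = D*`. -/
structure IsDelta (η : Ω → Measure Z) (ν : Measure Z) (P : Measure Ω)
    (u : Measure Z → Z → ℝ) (f : Measure Z → ℝ) : Prop where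
  dom : MemDomDelta η ν P u
  measurable : Measurable f
  memLp : MemLp (fun ω => f (η ω)) 2 P
  duality : ∀ G, MemDomD η ν P G →
    ∫ ω, G (η ω) * f (η ω) ∂P = ∫ ω, ∫ z, u (η ω) z * addOp G (η ω) z ∂ν ∂P

/-- The bracket `[u, v]_ν = ∫ u(z) ⊗ v(z) ν(dz)` of two (realized) vector fields, as a matrix. -/
def bracket {d : ℕ} (ν : Measure Z) (u v : Z → Vec d) : Mat d :=
  Matrix.of fun i j => ∫ z, u z i * v z j ∂ν

/-- The symmetrization of a matrix. -/
def symmetrize {d : ℕ} (A : Mat d) : Mat d := (1 / 2 : ℝ) • (A + A.transpose)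

/-- The bracket `[u, A]_ν = ∫ u(z) ⊗ A(z) ν(dz)` of a vector field and a matrix field: a
`3`-tensor, given by its coordinates. -/
def bracketMat {d : ℕ} (ν : Measure Z) (u : Z → Vec d) (A : Z → Mat d) :
    Fin d × Fin d × Fin d → ℝ :=
  fun p => ∫ z, u z p.1 * A z p.2.1 p.2.2 ∂ν

end PointConfig

section Stable

variable {Ω Ω' Z E : Type*} [MeasurableSpace Ω] [MeasurableSpace Ω'] [MeasurableSpace Z]
  [TopologicalSpace E] [MeasurableSpace E] [OpensMeasurableSpace (E × ℝ)]

/-- Stable convergence, with respect to the `σ`-algebra generated by `η`, of the sequence `X n` to a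
random element `X'`. The limit is defined on a probability space `Ω'` that extends `Ω` through a
measure preserving map `π`, so that the random variable `Y` on `Ω` is `Y ∘ π` on `Ω'`: for every
bounded `η`-measurable `Y`, the pairs `(X n, Y)` converge in law to `(X', Y)`. -/
def StablyTendsto (η : Ω → Measure Z) (P : Measure Ω) [IsProbabilityMeasure P]
    (X : ℕ → Ω → E) (P' : Measure Ω') [IsProbabilityMeasure P'] (π : Ω' → Ω) (X' : Ω' → E) :
    Prop :=
  MeasurePreserving π P' P ∧
  ∀ Y : Ω → ℝ, Measurable[sigmaAlg η] Y → (∃ C : ℝ, ∀ᵐ ω ∂P, |Y ω| ≤ C) →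
    TendstoInDistribution (fun n ω => (X n ω, Y ω)) atTop (fun ω' => (X' ω', Y (π ω')))
      (fun _ => P) P'

end Stable

end PoissonSpace

end

open PoissonSpace

namespace PoissonSpace

/-! ### Trigonometric functionals determine finite measures on the space of measures. -/

section SimpleIntegral

variable {Z : Type*} [MeasurableSpace Z]

/-! Fix a vector `l` and a bounded functional `Y` of `η`, and put V = exp(itY). By Lévy's theorem it
suffices to find the limit of E[exp(i⟨l, F_n⟩) V]. Two separate mechanisms give it.

Interpolation. For 0 ≤ r ≤ 1 let H_r = exp(i r ⟨l, F_n⟩) exp(-(1 - r²)|S_nᵀ l|²/2). It joins a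
conditional Gaussian characteristic function (r = 0) to exp(i⟨l, F_n⟩) (r = 1). In the derivative of
r ↦ E H_r, the term i E[⟨l, F_n⟩ H_r] becomes i E ∫ ⟨l, u_n⟩ D H_r dν because F_n = δ u_n. The
operator D obeys no chain rule, so D H_r is Taylor expanded. The first-order part in DF_n gives -r
(lᵀ [u_n, DF_n] l) H_r, which cancels r |S_nᵀ l|² H_r up to (ε); the first-order part in DS_n is
controlled by (RS); the quadratic remainder is controlled by (R₃) and (S₃). Hence E H_1 - E H_0 → 0
(`enorm_integral_interp_sub_le`).

Mixing. Bounded functionals whose add derivatives vanish in L¹ over sets of finite intensity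
decorrelate from every bounded functional of `η` (`IsPoissonProcess.tendsto_covariance`). Against
exp(i ∫ g dη) this follows from the Mecke formula: t ↦ E[H exp(it ∫ g dη)] solves the linear
differential equation of the Poisson characteristic functional up to an error linear in DH, and
Grönwall's inequality bounds the covariance (`IsPoissonProcess.norm_covariance_trig_le`). These
exponentials are total in L², which gives the general case. Conditions (Rh) and (Sh) make the
derivatives of H_0 and H_1 small locally.

Together, E[H_1 V] - E[H_0 V] → 0, and (C.st) gives the limit of E[H_0 V]
(`tendsto_integral_interp_zero`). -/

lemma SimpleFunc.measurable_integral (g : SimpleFunc Z ℝ) :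
    Measurable fun ξ : Measure Z => g.integral ξ := by
  classical
  simp only [SimpleFunc.integral_eq_sum_filter, smul_eq_mul, measureReal_def]
  refine Finset.measurable_sum _ fun x _ => Measurable.mul_const ?_ _
  exact (Measure.measurable_coe (g.measurableSet_preimage _)).ennreal_toReal

/-- The measure `ξ` is almost surely finite on the sets of finite intensity. -/
def AeLocallyFinite (ν : Measure Z) (μ : Measure (Measure Z)) : Prop :=
  ∀ B, MeasurableSet B → ν B < ∞ → ∀ᵐ ξ ∂μ, ξ B < ∞

lemma AeLocallyFinite.ae_integrable {ν : Measure Z} {μ : Measure (Measure Z)}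
    (h : AeLocallyFinite ν μ) {g : SimpleFunc Z ℝ} (hg : Integrable g ν) :
    ∀ᵐ ξ ∂μ, Integrable g ξ := by
  simp only [SimpleFunc.integrable_iff_finMeasSupp, SimpleFunc.finMeasSupp_iff_support] at hg ⊢
  exact h _ g.measurableSet_support hg

/-- The trigonometric functional `ξ ↦ exp (i ∫ g dξ)`. -/
noncomputable def trig (g : SimpleFunc Z ℝ) (ξ : Measure Z) : ℂ :=
  Complex.exp ((g.integral ξ : ℝ) * Complex.I)

lemma measurable_trig (g : SimpleFunc Z ℝ) : Measurable (trig g) := by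
  unfold trig
  have := SimpleFunc.measurable_integral g
  fun_prop

@[simp] lemma norm_trig (g : SimpleFunc Z ℝ) (ξ : Measure Z) : ‖trig g ξ‖ = 1 :=
  Complex.norm_exp_ofReal_mul_I _

/-- The witness is Σ t_B 1_B, one function for all `ξ`. Through it, the characteristic function of a
finite family of counts is the integral of a single `trig g`. -/
lemma exists_simpleFunc_sum (I : Finset {B : Set Z // MeasurableSet B}) (t : I → ℝ)
    (ν : Measure Z) (hν : ∀ B ∈ I, ν B.1 < ∞) :
    ∃ g : SimpleFunc Z ℝ, Integrable g ν ∧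
      ∀ ξ : Measure Z, (∀ B ∈ I, ξ B.1 < ∞) →
        g.integral ξ = ∑ B : I, ξ.real B.1.1 * t B := by
  classical
  have key : ∀ J : Finset I, ∃ g : SimpleFunc Z ℝ, 
      ∀ ξ : Measure Z, (∀ B ∈ I, ξ B.1 < ∞) → Integrable g ξ ∧
        g.integral ξ = ∑ B ∈ J, ξ.real B.1.1 * t B := by
    intro J
    induction J using Finset.induction_on with
    | empty =>
      refine ⟨SimpleFunc.const Z 0, fun ξ _ => ⟨?_, ?_⟩⟩
      · simp
      · rw [SimpleFunc.integral_const]; simp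
    | insert B J hB ih =>
      obtain ⟨g, hg⟩ := ih
      refine ⟨SimpleFunc.piecewise B.1.1 B.1.2 (SimpleFunc.const Z (t B)) (SimpleFunc.const Z 0) + g,
        fun ξ hξ => ?_⟩
      have h1 : Integrable
          (SimpleFunc.piecewise B.1.1 B.1.2 (SimpleFunc.const Z (t B)) (SimpleFunc.const Z 0)) ξ := by
        rw [SimpleFunc.coe_piecewise]
        refine Integrable.piecewise B.1.2 ?_ ?_
        · exact integrableOn_const (hξ _ B.2).ne
        · exact integrableOn_zero
      refine ⟨by simpa using h1.add (hg ξ hξ).1, ?_⟩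
      rw [SimpleFunc.integral_add h1 (hg ξ hξ).1, (hg ξ hξ).2, Finset.sum_insert hB]
      congr 1
      exact SimpleFunc.integral_piecewise_zero _ _ B.1.2 |>.trans (by
        rw [SimpleFunc.integral_const]; simp)
  obtain ⟨g, hg⟩ := key Finset.univ
  exact ⟨g, (hg ν hν).1, fun ξ hξ => (hg ξ hξ).2⟩

/-- The law of the values on a finite family of sets is characterized by the trigonometric
functionals. -/
lemma map_eval_eq {ν : Measure Z} {μ₁ μ₂ : Measure (Measure Z)} [IsFiniteMeasure μ₁]
    [IsFiniteMeasure μ₂] (h₁ : AeLocallyFinite ν μ₁) (h₂ : AeLocallyFinite ν μ₂)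
    (h : ∀ g : SimpleFunc Z ℝ, Integrable g ν → ∫ ξ, trig g ξ ∂μ₁ = ∫ ξ, trig g ξ ∂μ₂)
    (I : Finset {B : Set Z // MeasurableSet B}) (hI : ∀ B ∈ I, ν B.1 < ∞) :
    μ₁.map (fun ξ => WithLp.toLp 2 fun B : I => ξ.real B.1.1) =
      μ₂.map (fun ξ => WithLp.toLp 2 fun B : I => ξ.real B.1.1) := by
  have hm : Measurable
      (fun ξ : Measure Z => WithLp.toLp 2 fun B : I => ξ.real B.1.1) := by
    refine (WithLp.measurable_toLp 2 _).comp (measurable_pi_lambda _ fun B => ?_)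
    exact (Measure.measurable_coe B.1.2).ennreal_toReal
  refine Measure.ext_of_charFun (funext fun t => ?_)
  obtain ⟨g, hgν, hg⟩ := exists_simpleFunc_sum I t.ofLp ν hI
  have key : ∀ μ : Measure (Measure Z), AeLocallyFinite ν μ →
      charFun (μ.map (fun ξ => WithLp.toLp 2 fun B : I => ξ.real B.1.1)) t
        = ∫ ξ, trig g ξ ∂μ := by
    intro μ hμ
    rw [charFun_apply, integral_map hm.aemeasurable (by fun_prop)]
    refine integral_congr_ae ?_
    have : ∀ᵐ ξ ∂μ, ∀ B ∈ I, ξ B.1 < ∞ :=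
      (ae_ball_iff I.countable_toSet).2 fun B hB => hμ _ B.2 (hI B hB)
    filter_upwards [this] with ξ hξ
    rw [trig, hg ξ hξ]
    simp [PiLp.inner_apply, mul_comm]
  rw [key _ h₁, key _ h₂, h g hgν]

/-- By σ-finiteness `ξ B` is the supremum of its values on `B ∩ spanningSets ν n`, so evaluations on
sets of finite intensity already generate the σ-algebra. -/
lemma measurableSpace_eq_iSup (ν : Measure Z) [SigmaFinite ν] :
    (Measure.instMeasurableSpace : MeasurableSpace (Measure Z)) =
      ⨆ B ∈ {B : {B : Set Z // MeasurableSet B} | ν B.1 < ∞},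
        (borel ℝ≥0∞).comap fun ξ : Measure Z => ξ B.1 := by
  apply le_antisymm
  · refine iSup₂_le fun B hB => ?_
    rw [← measurable_iff_comap_le]
    have : (fun ξ : Measure Z => ξ B) = fun ξ => ⨆ n, ξ (B ∩ spanningSets ν n) := by
      ext ξ
      rw [← (monotone_const.inter (monotone_spanningSets ν)).measure_iUnion, ← Set.inter_iUnion,
        iUnion_spanningSets, Set.inter_univ]
    rw [this]
    refine Measurable.iSup fun n => ?_
    rw [measurable_iff_comap_le]
    exact le_iSup₂_of_le (f := fun (B : {B : Set Z // MeasurableSet B})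
      (_ : B ∈ {B : {B : Set Z // MeasurableSet B} | ν B.1 < ∞}) =>
      (borel ℝ≥0∞).comap fun ξ : Measure Z => ξ B.1)
      ⟨B ∩ spanningSets ν n, hB.inter (measurableSet_spanningSets ν n)⟩
      ((measure_mono Set.inter_subset_right).trans_lt (measure_spanningSets_lt_top ν n)) le_rfl
  · refine iSup₂_le fun B _ => ?_
    exact le_iSup₂_of_le (f := fun (B : Set Z) (_ : MeasurableSet B) =>
      (borel ℝ≥0∞).comap fun ξ : Measure Z => ξ B) B.1 B.2 le_rfl

/-- Two finite measures on the space of measures are equal as soon as they give the same integrals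
to the trigonometric functionals. -/
theorem measure_ext_of_trig {ν : Measure Z} [SigmaFinite ν] {μ₁ μ₂ : Measure (Measure Z)}
    [IsFiniteMeasure μ₁]
    [IsFiniteMeasure μ₂] (h₁ : AeLocallyFinite ν μ₁) (h₂ : AeLocallyFinite ν μ₂)
    (h : ∀ g : SimpleFunc Z ℝ, Integrable g ν → ∫ ξ, trig g ξ ∂μ₁ = ∫ ξ, trig g ξ ∂μ₂) :
    μ₁ = μ₂ := by
  have key : ∀ s ∈ piiUnionInter (fun B : {B : Set Z // MeasurableSet B} =>
      {s | MeasurableSet[(borel ℝ≥0∞).comap fun ξ : Measure Z => ξ B.1] s})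
      {B : {B : Set Z // MeasurableSet B} | ν B.1 < ∞}, μ₁ s = μ₂ s := by
    rintro _ ⟨I, hI, f, hf, rfl⟩
    have : ∀ B : I, ∃ T : Set ℝ≥0∞, MeasurableSet T ∧ (fun ξ : Measure Z => ξ B.1.1) ⁻¹' T = f B := by
      intro B
      obtain ⟨T, hT, hT'⟩ := hf B.1 B.2
      exact ⟨T, BorelSpace.measurable_eq (α := ℝ≥0∞) ▸ hT, hT'⟩
    choose T hT hTf using this
    have hm : Measurable
        (fun ξ : Measure Z => WithLp.toLp 2 fun B : I => ξ.real B.1.1) := by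
      refine (WithLp.measurable_toLp 2 _).comp (measurable_pi_lambda _ fun B => ?_)
      exact (Measure.measurable_coe B.1.2).ennreal_toReal
    -- Characteristic functions compare the real counts `ξ.real B`, whereas cylinders constrain `ξ
    -- B` in [0, ∞]. Since `ξ B` is almost surely finite, `ENNReal.ofReal` passes from one to the
    -- other up to a null set.
    have hU : MeasurableSet {x : EuclideanSpace ℝ I | ∀ B, ENNReal.ofReal (x B) ∈ T B} := by
      rw [Set.ofPred_forall]
      refine MeasurableSet.iInter fun B => ?_
      have : Measurable fun x : EuclideanSpace ℝ I => ENNReal.ofReal (x B) := by fun_prop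
      exact this (hT B)
    have key : ∀ μ : Measure (Measure Z), AeLocallyFinite ν μ → μ (⋂ B ∈ I, f B) =
        (μ.map (fun ξ => WithLp.toLp 2 fun B : I => ξ.real B.1.1))
          {x : EuclideanSpace ℝ I | ∀ B, ENNReal.ofReal (x B) ∈ T B} := by
      intro μ hμ
      rw [Measure.map_apply hm hU]
      refine measure_congr ?_
      have : ∀ᵐ ξ ∂μ, ∀ B ∈ I, ξ B.1 < ∞ :=
        (ae_ball_iff I.countable_toSet).2 fun B hB => hμ _ B.2 (hI hB)
      filter_upwards [this] with ξ hξ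
      apply propext
      change ξ ∈ ⋂ B ∈ I, f B ↔ ∀ B : I, ENNReal.ofReal (ξ.real B.1.1) ∈ T B
      simp only [Set.mem_iInter]
      constructor
      · intro hx B
        rw [measureReal_def, ENNReal.ofReal_toReal (hξ _ B.2).ne]
        have := hx B.1 B.2
        rw [← hTf B] at this
        exact this
      · intro hx B hB
        have := hx ⟨B, hB⟩
        rw [measureReal_def, ENNReal.ofReal_toReal (hξ _ hB).ne] at this
        rw [← hTf ⟨B, hB⟩]
        exact this
    rw [key _ h₁, key _ h₂, map_eval_eq h₁ h₂ h I hI]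
  refine ext_of_generate_finite _ ?_ (isPiSystem_piiUnionInter _
    (fun B => @MeasurableSpace.isPiSystem_measurableSet _ (_)) _) key ?_
  · exact (measurableSpace_eq_iSup ν).trans (generateFrom_piiUnionInter_measurableSet
      (fun B : {B : Set Z // MeasurableSet B} => (borel ℝ≥0∞).comap fun ξ : Measure Z => ξ B.1)
      {B | ν B.1 < ∞}).symm
  -- The cylinder over the empty family is the whole space, so the total masses agree.
  · exact key _ ⟨∅, by simp, fun _ => Set.univ, by simp, by simp⟩

end SimpleIntegral

/-! ### The characteristic functional of a Poisson process and the Mecke formula. -/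

section Mecke

variable {Ω Z : Type*} [MeasurableSpace Ω] [MeasurableSpace Z] {P : Measure Ω}
  {ν : Measure Z} {η : Ω → Measure Z}

lemma trig_add_dirac {g : SimpleFunc Z ℝ} {ξ : Measure Z} (hg : Integrable g ξ) (z : Z) :
    trig g (ξ + Measure.dirac z) = trig g ξ * Complex.exp (g z * Complex.I) := by
  have h1 : Integrable g (Measure.dirac z) :=
    integrable_dirac' g.stronglyMeasurable (by simp)
  have h2 : g.integral (Measure.dirac z) = g z := by
    rw [SimpleFunc.integral_eq_integral g h1, integral_dirac' _ _ g.stronglyMeasurable]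
  rw [trig, trig, SimpleFunc.integral_add_measure g (hg.add_measure h1), h2, ← Complex.exp_add]
  push_cast
  ring_nf

/-- The simple function `g + t 1_B`. -/
noncomputable def addIndicator (g : SimpleFunc Z ℝ) {B : Set Z} (hB : MeasurableSet B) (t : ℝ) :
    SimpleFunc Z ℝ :=
  g + SimpleFunc.piecewise B hB (SimpleFunc.const Z t) (SimpleFunc.const Z 0)

lemma addIndicator_apply (g : SimpleFunc Z ℝ) {B : Set Z} (hB : MeasurableSet B) (t : ℝ) (z : Z) :
    addIndicator g hB t z = g z + B.indicator (fun _ => t) z := by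
  classical
  simp [addIndicator, Set.indicator]

lemma integrable_addIndicator {g : SimpleFunc Z ℝ} {B : Set Z} (hB : MeasurableSet B) (t : ℝ)
    {ξ : Measure Z} (hg : Integrable g ξ) (hξ : ξ B < ∞) : Integrable (addIndicator g hB t) ξ := by
  have : (addIndicator g hB t : Z → ℝ) = fun z => g z + B.indicator (fun _ => t) z :=
    funext fun z => addIndicator_apply g hB t z
  rw [this]
  exact hg.add ((integrable_indicator_iff hB).2 (integrableOn_const hξ.ne))

lemma trig_addIndicator {g : SimpleFunc Z ℝ} {B : Set Z} (hB : MeasurableSet B) (t : ℝ)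
    {ξ : Measure Z} (hg : Integrable g ξ) (hξ : ξ B < ∞) :
    trig (addIndicator g hB t) ξ = trig g ξ * Complex.exp (t * (ξ.real B * Complex.I)) := by
  rw [trig, SimpleFunc.integral_eq_integral _ (integrable_addIndicator hB t hg hξ), trig,
    SimpleFunc.integral_eq_integral _ hg, ← Complex.exp_add]
  simp only [addIndicator_apply]
  rw [integral_add hg ((integrable_indicator_iff hB).2 (integrableOn_const hξ.ne)),
    integral_indicator hB]
  simp
  ring_nf

namespace IsPoissonProcess

lemma aemeasurable_eval (hη : IsPoissonProcess η ν P) {B : Set Z} (hB : MeasurableSet B) :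
    Measurable fun ω => η ω B :=
  (Measure.measurable_coe hB).comp hη.measurable

lemma map_real (hη : IsPoissonProcess η ν P) {B : Set Z} (hB : MeasurableSet B) (h : ν B < ∞) :
    P.map (fun ω => (η ω).real B) =
      (poissonMeasure (ν B).toNNReal).map (fun k : ℕ => (k : ℝ)) := by
  have : (fun ω => (η ω).real B) = ENNReal.toReal ∘ fun ω => η ω B := rfl
  rw [this, ← Measure.map_map ENNReal.measurable_toReal (hη.aemeasurable_eval hB), hη.law B hB h,
    Measure.map_map ENNReal.measurable_toReal (by fun_prop)]
  congr 1

lemma ae_lt_top (hη : IsPoissonProcess η ν P) {B : Set Z} (hB : MeasurableSet B) (h : ν B < ∞) :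
    ∀ᵐ ω ∂P, η ω B < ∞ := by
  have : ∀ᵐ x ∂(P.map fun ω => η ω B), x < ∞ := by
    rw [hη.law B hB h, ae_map_iff (by fun_prop) measurableSet_Iio]
    exact ae_of_all _ fun k => by simp
  exact ae_of_ae_map (hη.aemeasurable_eval hB).aemeasurable this

lemma aeLocallyFinite (hη : IsPoissonProcess η ν P) : AeLocallyFinite ν (P.map η) := by
  intro B hB h
  exact (ae_map_iff (p := fun ξ : Measure Z => ξ B < ∞) hη.measurable.aemeasurable
    ((Measure.measurable_coe hB) measurableSet_Iio)).2 (hη.ae_lt_top hB h)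

lemma ae_integrable (hη : IsPoissonProcess η ν P) {g : SimpleFunc Z ℝ} (hg : Integrable g ν) :
    ∀ᵐ ω ∂P, Integrable g (η ω) :=
  ae_of_ae_map hη.measurable.aemeasurable (hη.aeLocallyFinite.ae_integrable hg)

lemma integrable_real (hη : IsPoissonProcess η ν P) {B : Set Z} (hB : MeasurableSet B)
    (h : ν B < ∞) : Integrable (fun ω => (η ω).real B) P := by
  have hm : Measurable fun ω => (η ω).real B := (hη.aemeasurable_eval hB).ennreal_toReal
  have : Integrable (fun x : ℝ => x) (P.map fun ω => (η ω).real B) := by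
    rw [hη.map_real hB h, integrable_map_measure (by fun_prop) (by fun_prop),
      integrable_poissonMeasure_iff]
    set r : ℝ := ((ν B).toNNReal : ℝ)
    -- The term k = 0 vanishes, and k rᵏ / k! shifted by one index is r times the exponential
    -- series.
    rw [← summable_nat_add_iff 1]
    have h0 := ((Real.summable_pow_div_factorial r).mul_left (Real.exp (-r) * r))
    refine h0.congr fun n => ?_
    simp only [Function.comp_apply, Nat.factorial_succ, Nat.cast_mul, Nat.cast_add, Nat.cast_one]
    rw [Real.norm_of_nonneg (by positivity)]
    field_simp
    ring
  exact (integrable_map_measure (by fun_prop) hm.aemeasurable).1 this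

lemma integral_exp_real (hη : IsPoissonProcess η ν P) {B : Set Z} (hB : MeasurableSet B)
    (h : ν B < ∞) (t : ℝ) :
    ∫ ω, Complex.exp ((((η ω).real B * t : ℝ) : ℂ) * Complex.I) ∂P =
      Complex.exp (ν.real B * (Complex.exp (t * Complex.I) - 1)) := by
  have hm : Measurable fun ω => (η ω).real B := (hη.aemeasurable_eval hB).ennreal_toReal
  have := charFun_map_cast_poissonMeasure (ν B).toNNReal t
  rw [← hη.map_real hB h, charFun_apply, integral_map hm.aemeasurable (by fun_prop)] at this
  have h2 : (((ν B).toNNReal : ℝ) : ℂ) = ν.real B := rfl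
  rw [h2] at this
  simpa only [Real.inner_apply, mul_comm] using this

/-- The characteristic functional of a Poisson process. -/
theorem integral_trig (hη : IsPoissonProcess η ν P) {g : SimpleFunc Z ℝ} (hg : Integrable g ν) :
    ∫ ω, trig g (η ω) ∂P = Complex.exp (∫ z, (Complex.exp (g z * Complex.I) - 1) ∂ν) := by
  classical
  -- The level sets of nonzero values are disjoint and of finite intensity, so their counts are
  -- independent Poisson variables. The zero level set is dropped: its intensity may be infinite and
  -- it contributes nothing.
  set R := {x ∈ g.range | x ≠ 0} with hR
  have hfin : ∀ x : R, ν (g ⁻¹' {x.1}) < ∞ := by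
    intro x
    have h0 : x.1 ≠ 0 := (Finset.mem_filter.1 x.2).2
    exact SimpleFunc.FinMeasSupp.meas_preimage_singleton_ne_zero
      (SimpleFunc.integrable_iff_finMeasSupp.1 hg) h0
  let e : Fin (Fintype.card R) ≃ R := (Fintype.equivFin R).symm
  have hind := hη.indep (Fintype.card R) (fun i => g ⁻¹' {(e i).1})
    (fun i => g.measurableSet_preimage _) (by
      intro i j hij
      refine Disjoint.preimage _ ?_
      simpa using fun h => hij (e.injective (Subtype.ext h)))
  have hprod := hind.integral_fun_prod_comp
    (f := fun i x => Complex.exp (((x.toReal * (e i).1 : ℝ) : ℂ) * Complex.I))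
    (fun i => (hη.aemeasurable_eval (g.measurableSet_preimage _)).aemeasurable)
    (fun i => Measurable.aestronglyMeasurable (by fun_prop))
  have h1 : ∀ ω, trig g (η ω) = ∏ i, Complex.exp
      ((((η ω (g ⁻¹' {(e i).1})).toReal * (e i).1 : ℝ) : ℂ) * Complex.I) := by
    intro ω
    rw [trig, SimpleFunc.integral_eq_sum_filter, ← Complex.exp_sum, ← Finset.sum_mul,
      ← Complex.ofReal_sum]
    congr 3
    rw [e.sum_comp (fun x : R => (η ω (g ⁻¹' {x.1})).toReal * x.1),
      Finset.sum_coe_sort R fun x => (η ω (g ⁻¹' {x})).toReal * x]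
    simp [measureReal_def, hR]
  have h2 : ∀ i, ∫ ω, Complex.exp
      ((((η ω (g ⁻¹' {(e i).1})).toReal * (e i).1 : ℝ) : ℂ) * Complex.I) ∂P = _ :=
    fun i => hη.integral_exp_real (g.measurableSet_preimage _) (hfin (e i)) (e i).1
  simp only [h1]
  rw [hprod]
  simp only [h2]
  rw [← Complex.exp_sum]
  congr 1
  rw [e.sum_comp (fun x : R => (ν.real (g ⁻¹' {x.1}) : ℂ) * (Complex.exp (x.1 * Complex.I) - 1)),
      Finset.sum_coe_sort R fun x => (ν.real (g ⁻¹' {x}) : ℂ) * (Complex.exp (x * Complex.I) - 1)]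
  have h3 := SimpleFunc.map_integral g (fun x : ℝ => Complex.exp (x * Complex.I) - 1) hg (by simp)
  rw [SimpleFunc.integral_eq_integral] at h3
  · simp only [SimpleFunc.coe_map, Function.comp_apply] at h3
    rw [h3]
    rw [hR, Finset.sum_filter_of_ne]
    · exact Finset.sum_congr rfl fun x _ => by simp
    · intro x _ hx h0
      simp [h0] at hx
  · rw [SimpleFunc.integrable_iff_finMeasSupp] at hg ⊢
    exact hg.map (by simp)

end IsPoissonProcess

lemma integrable_exp_sub_one {g : SimpleFunc Z ℝ} (hg : Integrable g ν) :
    Integrable (fun z => Complex.exp (g z * Complex.I) - 1) ν := by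
  refine Integrable.mono' hg.norm ?_ (ae_of_all _ fun z => ?_)
  · have := g.measurable
    exact Measurable.aestronglyMeasurable (by fun_prop)
  · simpa [mul_comm] using Real.norm_exp_I_mul_ofReal_sub_one_le (x := g z)

lemma integrableOn_exp (g : SimpleFunc Z ℝ) {B : Set Z} (h : ν B < ∞) :
    IntegrableOn (fun z => Complex.exp (g z * Complex.I)) B ν := by
  refine IntegrableOn.of_bound h ?_ 1 (ae_of_all _ fun z => ?_)
  · have := g.measurable
    exact Measurable.aestronglyMeasurable (by fun_prop)
  · rw [Complex.norm_exp_ofReal_mul_I]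

namespace IsPoissonProcess

/-- This is the characteristic functional at g + t 1_B. Its exponent is affine in exp(it) - 1, ready
to be differentiated in t. -/
lemma integral_trig_mul_exp (hη : IsPoissonProcess η ν P) {g : SimpleFunc Z ℝ}
    (hg : Integrable g ν) {B : Set Z} (hB : MeasurableSet B) (h : ν B < ∞) (t : ℝ) :
    ∫ ω, trig g (η ω) * Complex.exp (t * ((η ω).real B * Complex.I)) ∂P =
      Complex.exp (∫ z, (Complex.exp (g z * Complex.I) - 1) ∂ν +
        (Complex.exp (t * Complex.I) - 1) * ∫ z in B, Complex.exp (g z * Complex.I) ∂ν) := by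
  have h1 : ∫ ω, trig g (η ω) * Complex.exp (t * ((η ω).real B * Complex.I)) ∂P =
      ∫ ω, trig (addIndicator g hB t) (η ω) ∂P := by
    refine integral_congr_ae ?_
    filter_upwards [hη.ae_integrable hg, hη.ae_lt_top hB h] with ω h1 h2
    rw [trig_addIndicator hB t h1 h2]
  rw [h1, hη.integral_trig (integrable_addIndicator hB t hg h), ← integral_indicator hB,
    ← integral_const_mul, ← integral_add (integrable_exp_sub_one hg)]
  · congr 2 with z
    rw [addIndicator_apply]
    by_cases hz : z ∈ B
    · simp only [hz, Set.indicator_of_mem]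
      push_cast
      rw [add_mul, Complex.exp_add]
      ring
    · simp [hz]
  · exact ((integrable_indicator_iff hB).2 (integrableOn_exp g h)).const_mul _

/-- Mecke formula for the trigonometric functionals. -/
lemma integral_real_mul_trig [IsProbabilityMeasure P] (hη : IsPoissonProcess η ν P)
    {g : SimpleFunc Z ℝ} (hg : Integrable g ν) {B : Set Z} (hB : MeasurableSet B) (h : ν B < ∞) :
    ∫ ω, ((η ω).real B : ℂ) * trig g (η ω) ∂P =
      (∫ z in B, Complex.exp (g z * Complex.I) ∂ν) * ∫ ω, trig g (η ω) ∂P := by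
  have hm : Measurable fun ω => (η ω).real B := (hη.aemeasurable_eval hB).ennreal_toReal
  have hmt : Measurable fun ω => trig g (η ω) := (measurable_trig g).comp hη.measurable
  -- Both sides of `integral_trig_mul_exp` are differentiated at t = 0, the left one under the
  -- integral with the dominating variable η(B). Uniqueness of the derivative gives the formula
  -- after division by i.
  have h1 := (hasDerivAt_integral_of_dominated_loc_of_deriv_le (μ := P) (x₀ := (0 : ℝ))
    (s := Set.univ) (F := fun (t : ℝ) ω =>
      trig g (η ω) * Complex.exp (t * ((η ω).real B * Complex.I)))
    (F' := fun (t : ℝ) ω => trig g (η ω) *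
      (Complex.exp (t * ((η ω).real B * Complex.I)) * (1 * ((η ω).real B * Complex.I))))
    (bound := fun ω => (η ω).real B) univ_mem
    (Eventually.of_forall fun t => Measurable.aestronglyMeasurable (by fun_prop))
    (Integrable.of_bound (C := 1) (Measurable.aestronglyMeasurable (by fun_prop))
      (ae_of_all _ fun ω => by simp))
    (Measurable.aestronglyMeasurable (by fun_prop))
    (ae_of_all _ fun ω t _ => by
      have : ((t : ℂ) * ((η ω).real B * Complex.I)) = ((t * (η ω).real B : ℝ) : ℂ) * Complex.I := by
        push_cast; ring
      rw [this, norm_mul, norm_mul, Complex.norm_exp_ofReal_mul_I, norm_trig]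
      simp [abs_of_nonneg])
    (hη.integrable_real hB h)
    (ae_of_all _ fun ω t _ =>
      (((Complex.ofRealCLM.hasDerivAt (x := t)).mul_const _).cexp.const_mul _))).2
  have h2 : HasDerivAt (fun t : ℝ => Complex.exp (∫ z, (Complex.exp (g z * Complex.I) - 1) ∂ν +
        (Complex.exp (t * Complex.I) - 1) * ∫ z in B, Complex.exp (g z * Complex.I) ∂ν)) _ 0 :=
    (((((Complex.ofRealCLM.hasDerivAt (x := (0 : ℝ))).mul_const Complex.I).cexp.sub_const
      1).mul_const _).const_add _).cexp
  simp only [hη.integral_trig_mul_exp hg hB h] at h1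
  have h3 := h1.unique h2
  simp only [Complex.ofReal_zero, zero_mul, Complex.exp_zero, one_mul, Complex.ofRealCLM_apply,
    sub_self, add_zero, Complex.ofReal_one, ← hη.integral_trig hg] at h3
  have h4 : (∫ ω, ((η ω).real B : ℂ) * trig g (η ω) ∂P) * Complex.I =
      ((∫ z in B, Complex.exp (g z * Complex.I) ∂ν) * ∫ ω, trig g (η ω) ∂P) * Complex.I := by
    rw [← integral_mul_const]
    convert! h3 using 1
    · exact integral_congr_ae (ae_of_all _ fun ω => by ring)
    · ring
  exact mul_right_cancel₀ Complex.I_ne_zero h4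

/-- The reduced Campbell measure and the law of the augmented process agree. -/
theorem mecke_measure [IsProbabilityMeasure P] [SigmaFinite ν] (hη : IsPoissonProcess η ν P)
    {B : Set Z} (hB : MeasurableSet B) (h : ν B < ∞) :
    (P.withDensity fun ω => η ω B).map η =
      (P.prod (ν.restrict B)).map fun p => η p.1 + Measure.dirac p.2 := by
  have hmB := hη.aemeasurable_eval hB
  have hlint : ∫⁻ ω, η ω B ∂P < ∞ := by
    have h1 := (hη.integrable_real hB h).lintegral_lt_top
    refine lt_of_le_of_lt (lintegral_mono_ae ?_) h1
    filter_upwards [hη.ae_lt_top hB h] with ω hω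
    rw [measureReal_def, ENNReal.ofReal_toReal hω.ne]
  -- Localizing to `B` keeps both measures finite, as `measure_ext_of_trig` requires.
  have hfin : IsFiniteMeasure (P.withDensity fun ω => η ω B) :=
    isFiniteMeasure_withDensity hlint.ne
  have hfin' : IsFiniteMeasure (ν.restrict B) := ⟨by simpa using h⟩
  have hadd : Measurable fun p : Ω × Z => η p.1 + Measure.dirac p.2 :=
    (hη.measurable.comp measurable_fst).add (Measure.measurable_dirac.comp measurable_snd)
  refine measure_ext_of_trig (ν := ν) ?_ ?_ ?_
  · intro C hC hνC
    have := (ae_map_iff (p := fun ξ : Measure Z => ξ C < ∞) hη.measurable.aemeasurable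
      ((Measure.measurable_coe hC) measurableSet_Iio) (μ := P.withDensity fun ω => η ω B)).2
    exact this ((withDensity_absolutelyContinuous P _).ae_le (hη.ae_lt_top hC hνC))
  · intro C hC hνC
    have := (ae_map_iff (p := fun ξ : Measure Z => ξ C < ∞) hadd.aemeasurable
      ((Measure.measurable_coe hC) measurableSet_Iio) (μ := P.prod (ν.restrict B))).2
    refine this ?_
    filter_upwards [Measure.quasiMeasurePreserving_fst.ae (hη.ae_lt_top hC hνC)] with p hp
    simp only [Measure.coe_add, Pi.add_apply]
    exact ENNReal.add_lt_top.2 ⟨hp, measure_lt_top _ _⟩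
  · intro g hg
    have hmt := measurable_trig g
    rw [integral_map hη.measurable.aemeasurable hmt.aestronglyMeasurable,
      integral_map hadd.aemeasurable hmt.aestronglyMeasurable,
      integral_withDensity_eq_integral_toReal_smul hmB (hη.ae_lt_top hB h)]
    have h1 := hη.integral_real_mul_trig hg hB h
    simp only [Complex.real_smul]
    refine h1.trans ?_
    rw [mul_comm, ← integral_prod_mul]
    refine integral_congr_ae ?_
    filter_upwards [Measure.quasiMeasurePreserving_fst.ae (hη.ae_integrable hg)] with p hp
    rw [trig_add_dirac hp]

/-- The Mecke formula on a set of finite intensity. -/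
theorem mecke [IsProbabilityMeasure P] [SigmaFinite ν] (hη : IsPoissonProcess η ν P)
    {B : Set Z} (hB : MeasurableSet B) (h : ν B < ∞) {G : Measure Z → ℂ} (hG : Measurable G) :
    ∫ ω, ((η ω).real B : ℂ) * G (η ω) ∂P =
      ∫ p, G (η p.1 + Measure.dirac p.2) ∂(P.prod (ν.restrict B)) := by
  have hadd : Measurable fun p : Ω × Z => η p.1 + Measure.dirac p.2 :=
    (hη.measurable.comp measurable_fst).add (Measure.measurable_dirac.comp measurable_snd)
  rw [← integral_map hadd.aemeasurable hG.aestronglyMeasurable, ← hη.mecke_measure hB h,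
    integral_map hη.measurable.aemeasurable hG.aestronglyMeasurable,
    integral_withDensity_eq_integral_toReal_smul (hη.aemeasurable_eval hB) (hη.ae_lt_top hB h)]
  rfl

lemma measurable_add_dirac (hη : IsPoissonProcess η ν P) :
    Measurable fun p : Ω × Z => η p.1 + Measure.dirac p.2 :=
  (hη.measurable.comp measurable_fst).add (Measure.measurable_dirac.comp measurable_snd)

/-- The Mecke formula for the integral of a simple function. -/
theorem mecke_simpleFunc [IsProbabilityMeasure P] [SigmaFinite ν] (hη : IsPoissonProcess η ν P)
    {g : SimpleFunc Z ℝ} (hg : Integrable g ν) {G : Measure Z → ℂ} (hG : Measurable G) {C : ℝ}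
    (hC : ∀ ξ, ‖G ξ‖ ≤ C) :
    ∫ ω, ((g.integral (η ω) : ℝ) : ℂ) * G (η ω) ∂P =
      ∫ p, (g p.2 : ℂ) * G (η p.1 + Measure.dirac p.2) ∂(P.prod ν) := by
  classical
  have hfin : ∀ x ∈ {x ∈ g.range | x ≠ 0}, ν (g ⁻¹' {x}) < ∞ := fun x hx =>
    SimpleFunc.FinMeasSupp.meas_preimage_singleton_ne_zero
      (SimpleFunc.integrable_iff_finMeasSupp.1 hg) (Finset.mem_filter.1 hx).2
  have hms : ∀ x, MeasurableSet (g ⁻¹' {x}) := fun x => g.measurableSet_preimage _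
  have hGm := hG.comp hη.measurable_add_dirac
  have h1 : ∀ ω, ((g.integral (η ω) : ℝ) : ℂ) * G (η ω) =
      ∑ x ∈ {x ∈ g.range | x ≠ 0}, (x : ℂ) * (((η ω).real (g ⁻¹' {x}) : ℂ) * G (η ω)) := by
    intro ω
    rw [SimpleFunc.integral_eq_sum_filter, Complex.ofReal_sum, Finset.sum_mul]
    exact Finset.sum_congr rfl fun x _ => by simp; ring
  have h2 : ∀ p : Ω × Z, (g p.2 : ℂ) * G (η p.1 + Measure.dirac p.2) =
      ∑ x ∈ {x ∈ g.range | x ≠ 0}, (x : ℂ) * (Set.univ ×ˢ (g ⁻¹' {x})).indicator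
        (fun p : Ω × Z => G (η p.1 + Measure.dirac p.2)) p := by
    intro p
    by_cases h0 : g p.2 = 0
    · rw [h0, Finset.sum_eq_zero]
      · simp
      · intro x hx
        have : p ∉ Set.univ ×ˢ (g ⁻¹' {x}) := by
          simpa [h0] using (Finset.mem_filter.1 hx).2.symm
        simp [this]
    · rw [Finset.sum_eq_single (g p.2)]
      · have : p ∈ Set.univ ×ˢ (g ⁻¹' {g p.2}) := by simp
        simp [this]
      · intro x _ hx
        have : p ∉ Set.univ ×ˢ (g ⁻¹' {x}) := by simpa using hx.symm
        simp [this]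
      · simp [h0]
  simp only [h1, h2]
  rw [integral_finsetSum, integral_finsetSum]
  · refine Finset.sum_congr rfl fun x hx => ?_
    rw [integral_const_mul, integral_const_mul, hη.mecke (hms x) (hfin x hx) hG,
      integral_indicator (MeasurableSet.univ.prod (hms x)), ← Measure.prod_restrict,
      Measure.restrict_univ]
  · intro x hx
    refine Integrable.const_mul ?_ _
    rw [integrable_indicator_iff (MeasurableSet.univ.prod (hms x))]
    refine IntegrableOn.of_bound ?_ hGm.aestronglyMeasurable C (ae_of_all _ fun p => hC _)
    rw [Measure.prod_prod]
    simpa using hfin x hx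
  · intro x hx
    refine Integrable.const_mul ?_ _
    exact (hη.integrable_real (hms x) (hfin x hx)).ofReal.mul_bdd (c := C)
      (hG.comp hη.measurable).aestronglyMeasurable (ae_of_all _ fun ω => hC _)

end IsPoissonProcess
end Mecke

/-! ### Covariance with a trigonometric functional, by Mecke and Grönwall. -/

section Mixing

variable {Ω Z : Type*} [MeasurableSpace Ω] [MeasurableSpace Z] {P : Measure Ω}
  {ν : Measure Z} {η : Ω → Measure Z}

lemma simpleFunc_integral_add_dirac {g : SimpleFunc Z ℝ} {ξ : Measure Z} (hg : Integrable g ξ)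
    (z : Z) : g.integral (ξ + Measure.dirac z) = g.integral ξ + g z := by
  have h1 : Integrable g (Measure.dirac z) :=
    integrable_dirac' g.stronglyMeasurable (by simp)
  rw [SimpleFunc.integral_add_measure g (hg.add_measure h1),
    SimpleFunc.integral_eq_integral g h1, integral_dirac' _ _ g.stronglyMeasurable]

namespace IsPoissonProcess

lemma integrable_simpleFunc_integral (hη : IsPoissonProcess η ν P) {g : SimpleFunc Z ℝ}
    (hg : Integrable g ν) : Integrable (fun ω => g.integral (η ω)) P := by
  classical
  simp only [SimpleFunc.integral_eq_sum_filter, smul_eq_mul]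
  refine integrable_finsetSum _ fun x hx => (hη.integrable_real (g.measurableSet_preimage _)
    (SimpleFunc.FinMeasSupp.meas_preimage_singleton_ne_zero
      (SimpleFunc.integrable_iff_finMeasSupp.1 hg) (Finset.mem_filter.1 hx).2)).mul_const _

/-- `t ↦ E [H exp (i t ∫ g dη)]` solves, up to the add derivative of `H`, the same linear
differential equation as the characteristic functional. -/
lemma hasDerivAt_integral_mul_exp [IsProbabilityMeasure P] [SigmaFinite ν]
    (hη : IsPoissonProcess η ν P)
    {g : SimpleFunc Z ℝ} (hg : Integrable g ν) {H : Measure Z → ℂ} (hH : Measurable H)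
    (hH1 : ∀ ξ, ‖H ξ‖ ≤ 1) (t : ℝ) :
    HasDerivAt (fun t : ℝ => ∫ ω, H (η ω) * Complex.exp (t * (g.integral (η ω) * Complex.I)) ∂P)
      (Complex.I * (∫ z, (g z : ℂ) * Complex.exp (t * (g z * Complex.I)) ∂ν) *
          (∫ ω, H (η ω) * Complex.exp (t * ((g.integral (η ω) : ℝ) * Complex.I)) ∂P) +
        Complex.I * ∫ p, (g p.2 : ℂ) * Complex.exp (t * (g p.2 * Complex.I)) *
          (Complex.exp (t * ((g.integral (η p.1) : ℝ) * Complex.I)) * addOp H (η p.1) p.2)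
          ∂(P.prod ν)) t := by
  have hexp : ∀ (t x : ℝ), ‖Complex.exp (t * (x * Complex.I))‖ = 1 := fun t x => by
    rw [show ((t : ℂ) * (x * Complex.I)) = ((t * x : ℝ) : ℂ) * Complex.I by push_cast; ring,
      Complex.norm_exp_ofReal_mul_I]
  have hm0 : Measurable fun ξ : Measure Z => g.integral ξ := SimpleFunc.measurable_integral g
  have hm : Measurable fun ω => g.integral (η ω) := hm0.comp hη.measurable
  have hηm := hη.measurable
  have hHm : Measurable fun ω => H (η ω) := hH.comp hη.measurable
  have hgm := g.measurable
  have h1 := (hasDerivAt_integral_of_dominated_loc_of_deriv_le (μ := P) (x₀ := t)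
    (s := Set.univ) (F := fun (t : ℝ) ω =>
      H (η ω) * Complex.exp (t * ((g.integral (η ω) : ℝ) * Complex.I)))
    (F' := fun (t : ℝ) ω => H (η ω) *
      (Complex.exp (t * ((g.integral (η ω) : ℝ) * Complex.I)) *
        (1 * ((g.integral (η ω) : ℝ) * Complex.I))))
    (bound := fun ω => |g.integral (η ω)|) univ_mem
    (Eventually.of_forall fun t => Measurable.aestronglyMeasurable (by fun_prop))
    (Integrable.of_bound (C := 1) (Measurable.aestronglyMeasurable (by fun_prop))
      (ae_of_all _ fun ω => by rw [norm_mul, hexp]; simpa using hH1 _))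
    (Measurable.aestronglyMeasurable (by fun_prop))
    (ae_of_all _ fun ω t _ => by
      rw [norm_mul, norm_mul, hexp]
      simpa using mul_le_of_le_one_left (abs_nonneg (g.integral (η ω))) (hH1 (η ω)))
    (hη.integrable_simpleFunc_integral hg).abs
    (ae_of_all _ fun ω t _ =>
      (((Complex.ofRealCLM.hasDerivAt (x := t)).mul_const _).cexp.const_mul _))).2
  convert! h1 using 1
  -- Differentiation brings down ∫ g dη, which Mecke turns into an integral over ν at the shifted
  -- configuration. There H(η + δ_z) = H(η) + D_z H: the first summand factorizes into the
  -- coefficient of the equation times the function itself, the second is the error.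
  have hmecke := hη.mecke_simpleFunc hg
    (G := fun ξ => H ξ * Complex.exp (t * ((g.integral ξ : ℝ) * Complex.I))) (C := 1)
    (by fun_prop) (fun ξ => by rw [norm_mul, hexp]; simpa using hH1 _)
  have h2 : ∫ ω, H (η ω) * (Complex.exp (t * ((g.integral (η ω) : ℝ) * Complex.I)) *
        (1 * ((g.integral (η ω) : ℝ) * Complex.I))) ∂P = Complex.I * ∫ ω,
        ((g.integral (η ω) : ℝ) : ℂ) * 
          (H (η ω) * Complex.exp (t * ((g.integral (η ω) : ℝ) * Complex.I))) ∂P := by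
    rw [← integral_const_mul]
    exact integral_congr_ae (ae_of_all _ fun ω => by ring)
  rw [h2, hmecke, mul_assoc, ← mul_add, mul_comm (∫ z, _ ∂ν), ← integral_prod_mul, ← integral_add]
  · congr 1
    refine integral_congr_ae ?_
    filter_upwards [Measure.quasiMeasurePreserving_fst.ae (hη.ae_integrable hg)] with p hp
    simp only [simpleFunc_integral_add_dirac hp, addOp]
    push_cast
    rw [add_mul, mul_add, Complex.exp_add]
    ring
  · refine (Integrable.mul_prod (f := fun ω => H (η ω) *
      Complex.exp (t * ((g.integral (η ω) : ℝ) * Complex.I)))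
      (g := fun z => (g z : ℂ) * Complex.exp (t * (g z * Complex.I))) ?_ ?_)
    · exact (Integrable.of_bound (C := 1) (Measurable.aestronglyMeasurable (by fun_prop))
        (ae_of_all _ fun ω => by rw [norm_mul, hexp]; simpa using hH1 _))
    · exact hg.ofReal.mul_bdd (c := 1) (Measurable.aestronglyMeasurable (by fun_prop))
        (ae_of_all _ fun z => (hexp _ _).le)
  · refine Integrable.mul_bdd (c := 2) ?_ ?_ (ae_of_all _ fun p => ?_)
    · have : Integrable (fun p : Ω × Z => (1 : ℂ) * ((g p.2 : ℂ) * 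
          Complex.exp (t * (g p.2 * Complex.I)))) (P.prod ν) :=
        Integrable.mul_prod (f := fun _ => (1 : ℂ))
          (g := fun z => (g z : ℂ) * Complex.exp (t * (g z * Complex.I)))
          (integrable_const _) (hg.ofReal.mul_bdd (c := 1)
            (Measurable.aestronglyMeasurable (by fun_prop)) (ae_of_all _ fun z => (hexp _ _).le))
      simpa using this
    · refine Measurable.aestronglyMeasurable (Measurable.mul (by fun_prop) ?_)
      exact (hH.comp hη.measurable_add_dirac).sub (hHm.comp measurable_fst)
    · rw [norm_mul, hexp, one_mul]
      exact (norm_sub_le _ _).trans (by linarith [hH1 (η p.1 + Measure.dirac p.2), hH1 (η p.1)])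

/-- The covariance of a bounded functional `H` and a trigonometric functional is controlled by the
add derivative of `H`. -/
theorem norm_covariance_trig_le [IsProbabilityMeasure P] [SigmaFinite ν]
    (hη : IsPoissonProcess η ν P)
    {g : SimpleFunc Z ℝ} (hg : Integrable g ν) {H : Measure Z → ℂ} (hH : Measurable H)
    (hH1 : ∀ ξ, ‖H ξ‖ ≤ 1) :
    ‖∫ ω, H (η ω) * trig g (η ω) ∂P - (∫ ω, H (η ω) ∂P) * ∫ ω, trig g (η ω) ∂P‖ ≤
      (∫ p, |g p.2| * ‖addOp H (η p.1) p.2‖ ∂(P.prod ν)) * Real.exp (∫ z, |g z| ∂ν + 1) := by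
  have hexp : ∀ (t x : ℝ), ‖Complex.exp (t * (x * Complex.I))‖ = 1 := fun t x => by
    rw [show ((t : ℂ) * (x * Complex.I)) = ((t * x : ℝ) : ℂ) * Complex.I by push_cast; ring,
      Complex.norm_exp_ofReal_mul_I]
  set c := ∫ ω, H (η ω) ∂P with hc
  set E := ∫ p, |g p.2| * ‖addOp H (η p.1) p.2‖ ∂(P.prod ν) with hE
  -- The added 1 makes `K` nonzero in the Grönwall bound and gives `E / K ≤ E`.
  set K := ∫ z, |g z| ∂ν + 1 with hK
  have hE0 : 0 ≤ E := by positivity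
  have hK1 : 1 ≤ K := by have : 0 ≤ ∫ z, |g z| ∂ν := by positivity
                         linarith
  have hc1 : ‖c‖ ≤ 1 := by
    refine (norm_integral_le_of_norm_le_const (C := 1) (ae_of_all _ fun ω => hH1 _)).trans ?_
    simp
  have hd1 := hη.hasDerivAt_integral_mul_exp hg hH hH1
  -- For H = 1 the add derivative vanishes and the same equation holds without error. The difference
  -- `ΦH - c * Φ1` therefore satisfies it with the error of H alone, and it is zero at t = 0 because
  -- c = E H.
  have hd2 := hη.hasDerivAt_integral_mul_exp hg (H := fun _ => 1) measurable_const (by simp)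
  set ΦH := fun t : ℝ => ∫ ω, H (η ω) * Complex.exp (t * (g.integral (η ω) * Complex.I)) ∂P with hΦ
  set Φ1 := fun t : ℝ => ∫ ω, 1 * Complex.exp (t * ((g.integral (η ω) : ℝ) * Complex.I)) ∂P with hΦ1
  have hderiv := fun t => (hd1 t).sub ((hd2 t).const_mul c)
  have hgr := norm_le_gronwallBound_of_norm_deriv_right_le (f := fun t => ΦH t - c * Φ1 t)
    (δ := 0) (K := K) (ε := E) (a := 0) (b := 1)
    (fun t _ => (hderiv t).continuousAt.continuousWithinAt)
    (fun t _ => (hderiv t).hasDerivWithinAt)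
    (by simp [hΦ, hΦ1, hc]) (fun t _ => by
      set m := ∫ z, (g z : ℂ) * Complex.exp (t * (g z * Complex.I)) ∂ν
      have hm : ‖m‖ ≤ K := by
        refine (norm_integral_le_integral_norm _).trans ?_
        simp only [norm_mul, hexp, mul_one, Complex.norm_real, Real.norm_eq_abs]
        linarith
      have he : ‖∫ p, (g p.2 : ℂ) * Complex.exp (t * (g p.2 * Complex.I)) *
          (Complex.exp (t * ((g.integral (η p.1) : ℝ) * Complex.I)) * addOp H (η p.1) p.2)
          ∂(P.prod ν)‖ ≤ E := by
        refine (norm_integral_le_integral_norm _).trans (le_of_eq ?_)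
        simp only [norm_mul, hexp, mul_one, Complex.norm_real, Real.norm_eq_abs, one_mul, hE]
      set err := ∫ p, (g p.2 : ℂ) * Complex.exp (t * (g p.2 * Complex.I)) *
          (Complex.exp (t * ((g.integral (η p.1) : ℝ) * Complex.I)) * addOp H (η p.1) p.2)
          ∂(P.prod ν)
      have hadd1 : ∀ p : Ω × Z, addOp (fun _ : Measure Z => (1 : ℂ)) (η p.1) p.2 = 0 :=
        fun p => by simp [addOp]
      simp only [hadd1, mul_zero, integral_zero, add_zero]
      change ‖Complex.I * m * ΦH t + Complex.I * err - c * (Complex.I * m * Φ1 t)‖ ≤ _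
      rw [show Complex.I * m * ΦH t + Complex.I * err - c * (Complex.I * m * Φ1 t) =
        Complex.I * (m * (ΦH t - c * Φ1 t)) + Complex.I * err by ring]
      refine (norm_add_le _ _).trans ?_
      simp only [norm_mul, Complex.norm_I, one_mul]
      gcongr)
    1 (by simp)
  have h1 : ΦH 1 - c * Φ1 1 =
      ∫ ω, H (η ω) * trig g (η ω) ∂P - c * ∫ ω, trig g (η ω) ∂P := by
    simp [hΦ, hΦ1, trig]
  rw [← h1]
  refine hgr.trans ?_
  rw [gronwallBound_of_K_ne_0 (by positivity)]
  simp only [zero_mul, zero_add, sub_zero, mul_one]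
  have : E / K ≤ E := div_le_self hE0 hK1
  have h2 : 0 ≤ Real.exp K - 1 := by linarith [Real.add_one_le_exp K]
  calc E / K * (Real.exp K - 1) ≤ E * (Real.exp K - 1) := by gcongr
    _ ≤ E * Real.exp K := by gcongr; linarith

end IsPoissonProcess
end Mixing

/-- The good test vectors form a subspace, which is dense because nothing nonzero is orthogonal to
`S`; the uniform bound on `X n` carries the convergence to the closure. -/
lemma tendsto_inner_zero_of_total {E : Type*} [NormedAddCommGroup E] [InnerProductSpace ℂ E]
    [CompleteSpace E] {X : ℕ → E} {C : ℝ} (hX : ∀ n, ‖X n‖ ≤ C) (S : Set E)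
    (hS : ∀ v ∈ S, Tendsto (fun n => inner ℂ (X n) v) atTop (𝓝 0))
    (htot : ∀ x, (∀ v ∈ S, inner ℂ v x = 0) → x = 0) (V : E) :
    Tendsto (fun n => inner ℂ (X n) V) atTop (𝓝 0) := by
  let D : Submodule ℂ E :=
    { carrier := {v | Tendsto (fun n => inner ℂ (X n) v) atTop (𝓝 0)}
      add_mem' := fun {a b} ha hb => by
        simpa [inner_add_right] using Tendsto.add ha hb
      zero_mem' := by simp
      smul_mem' := fun c x hx => by
        simpa [inner_smul_right] using Tendsto.const_mul c hx }
  have hperp : Dᗮ = ⊥ := by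
    rw [Submodule.eq_bot_iff]
    exact fun x hx => htot x fun v hv => (Submodule.mem_orthogonal D x).1 hx v (hS v hv)
  have hdense := D.topologicalClosure_eq_top_iff.2 hperp
  have hV : V ∈ closure (D : Set E) := by
    rw [← Submodule.topologicalClosure_coe, hdense]; trivial
  have hC : 0 ≤ C := (norm_nonneg _).trans (hX 0)
  rw [Metric.tendsto_atTop]
  intro ε hε
  -- Dividing by `C + 1` rather than `C` covers the case `C = 0`.
  obtain ⟨v, hv, hvV⟩ := Metric.mem_closure_iff.1 hV (ε / 2 / (C + 1)) (by positivity)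
  obtain ⟨N, hN⟩ := Metric.tendsto_atTop.1 hv (ε / 2) (by positivity)
  refine ⟨N, fun n hn => ?_⟩
  have h1 := hN n hn
  rw [dist_zero_right] at h1 ⊢
  have h2 : inner ℂ (X n) V = inner ℂ (X n) v + inner ℂ (X n) (V - v) := by
    rw [← inner_add_right]; simp
  rw [dist_eq_norm] at hvV
  have h3 : ‖(inner ℂ (X n) (V - v) : ℂ)‖ ≤ ε / 2 := by
    refine (norm_inner_le_norm _ _).trans ?_
    calc ‖X n‖ * ‖V - v‖ ≤ C * (ε / 2 / (C + 1)) := by gcongr; exact hX n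
      _ ≤ (C + 1) * (ε / 2 / (C + 1)) := by gcongr; linarith
      _ = ε / 2 := by field_simp
  rw [h2]
  linarith [norm_add_le (inner ℂ (X n) v : ℂ) (inner ℂ (X n) (V - v))]

/-! ### Totality of the trigonometric functionals and asymptotic independence. -/

section Mixing

variable {Ω Z : Type*} [MeasurableSpace Ω] [MeasurableSpace Z] {P : Measure Ω}
  {ν : Measure Z} {η : Ω → Measure Z}

/-- The positive and negative parts of `x` are densities of two finite measures with equal
trigonometric integrals. The measures coincide, so the two parts agree almost everywhere, and both
vanish since at most one is nonzero at each point. -/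
lemma ae_eq_zero_of_integral_trig [SigmaFinite ν] {Q : Measure (Measure Z)} [IsFiniteMeasure Q]
    (hQ : AeLocallyFinite ν Q) {x : Measure Z → ℝ} (hx : Integrable x Q)
    (h : ∀ g : SimpleFunc Z ℝ, Integrable g ν → ∫ ξ, (x ξ : ℂ) * trig g ξ ∂Q = 0) :
    x =ᵐ[Q] 0 := by
  have hfin1 : ∫⁻ ξ, ENNReal.ofReal (x ξ) ∂Q ≠ ∞ := hx.lintegral_lt_top.ne
  have hfin2 : ∫⁻ ξ, ENNReal.ofReal (-x ξ) ∂Q ≠ ∞ := hx.neg.lintegral_lt_top.ne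
  have hm1 : AEMeasurable (fun ξ => ENNReal.ofReal (x ξ)) Q := hx.aemeasurable.ennreal_ofReal
  have hm2 : AEMeasurable (fun ξ => ENNReal.ofReal (-x ξ)) Q := hx.neg.aemeasurable.ennreal_ofReal
  have := isFiniteMeasure_withDensity hfin1
  have := isFiniteMeasure_withDensity hfin2
  have heq : Q.withDensity (fun ξ => ENNReal.ofReal (x ξ)) =
      Q.withDensity (fun ξ => ENNReal.ofReal (-x ξ)) := by
    refine measure_ext_of_trig (ν := ν)
      (fun B hB hνB => (withDensity_absolutelyContinuous Q _).ae_le (hQ B hB hνB))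
      (fun B hB hνB => (withDensity_absolutelyContinuous Q _).ae_le (hQ B hB hνB)) fun g hg => ?_
    rw [integral_withDensity_eq_integral_toReal_smul₀ hm1 (by simp),
      integral_withDensity_eq_integral_toReal_smul₀ hm2 (by simp), ← sub_eq_zero, ← integral_sub,
      ← h g hg]
    · refine integral_congr_ae (ae_of_all _ fun ξ => ?_)
      simp only [Complex.real_smul, ← sub_mul, ← Complex.ofReal_sub]
      congr 2
      rcases le_total 0 (x ξ) with h0 | h0
      · rw [ENNReal.toReal_ofReal h0, ENNReal.ofReal_of_nonpos (by linarith)]; simp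
      · rw [ENNReal.toReal_ofReal (neg_nonneg.2 h0), ENNReal.ofReal_of_nonpos h0]; simp
    · simp only [Complex.real_smul]
      exact (integrable_toReal_of_lintegral_ne_top hm1 hfin1).ofReal.mul_bdd (c := 1)
          (measurable_trig g).aestronglyMeasurable (ae_of_all _ fun ξ => (norm_trig g ξ).le)
    · simp only [Complex.real_smul]
      exact (integrable_toReal_of_lintegral_ne_top hm2 hfin2).ofReal.mul_bdd (c := 1)
          (measurable_trig g).aestronglyMeasurable (ae_of_all _ fun ξ => (norm_trig g ξ).le)
  have hae := (withDensity_eq_iff hm1 hm2 hfin1).1 heq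
  filter_upwards [hae] with ξ hξ
  rcases le_total 0 (x ξ) with h0 | h0
  · rw [ENNReal.ofReal_of_nonpos (by linarith : -x ξ ≤ 0), ENNReal.ofReal_eq_zero] at hξ
    exact le_antisymm hξ h0
  · rw [ENNReal.ofReal_of_nonpos h0, eq_comm, ENNReal.ofReal_eq_zero] at hξ
    exact le_antisymm h0 (neg_nonpos.1 hξ)

lemma conj_trig {g : SimpleFunc Z ℝ} {ξ : Measure Z} (hg : Integrable g ξ) :
    starRingEnd ℂ (trig g ξ) = trig (-g) ξ := by
  rw [trig, trig, SimpleFunc.integral_neg hg, ← Complex.exp_conj]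
  simp

/-- Trigonometric functionals are total in `L²`. -/
lemma ae_eq_zero_of_integral_trig_complex [SigmaFinite ν] {Q : Measure (Measure Z)}
    [IsFiniteMeasure Q] (hQ : AeLocallyFinite ν Q) {x : Measure Z → ℂ} (hx : Integrable x Q)
    (h : ∀ g : SimpleFunc Z ℝ, Integrable g ν → ∫ ξ, x ξ * trig g ξ ∂Q = 0) :
    x =ᵐ[Q] 0 := by
  have hint : ∀ g : SimpleFunc Z ℝ, Integrable (fun ξ => x ξ * trig g ξ) Q := fun g =>
    hx.mul_bdd (c := 1) (measurable_trig g).aestronglyMeasurable (ae_of_all _ fun ξ => by simp)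
  have hint' : ∀ g : SimpleFunc Z ℝ, Integrable (fun ξ => starRingEnd ℂ (x ξ) * trig g ξ) Q := 
    fun g => (Complex.conjLIE.integrable_comp_iff.2 hx).mul_bdd (c := 1)
      (measurable_trig g).aestronglyMeasurable (ae_of_all _ fun ξ => by simp)
  -- Trigonometric functionals are stable under conjugation (g ↦ -g), so the conjugate of `x`
  -- satisfies the same relations; hence so do its real and imaginary parts.
  have h' : ∀ g : SimpleFunc Z ℝ, Integrable g ν →
      ∫ ξ, starRingEnd ℂ (x ξ) * trig g ξ ∂Q = 0 := by
    intro g hg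
    have h1 := h (-g) (by simpa using hg.neg)
    have h2 := congrArg (starRingEnd ℂ) h1
    rw [← integral_conj, map_zero] at h2
    rw [← h2]
    refine integral_congr_ae ?_
    filter_upwards [hQ.ae_integrable hg] with ξ hξ
    rw [map_mul, ← conj_trig hξ, Complex.conj_conj]
  have hre := ae_eq_zero_of_integral_trig hQ hx.re fun g hg => by
    have : ∀ ξ, ((RCLike.re (x ξ) : ℝ) : ℂ) * trig g ξ =
        (1 / 2 : ℂ) * (x ξ * trig g ξ + starRingEnd ℂ (x ξ) * trig g ξ) := fun ξ => by
      rw [← add_mul, Complex.add_conj]; simp; ring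
    simp only [this]
    rw [integral_const_mul, integral_add (hint g) (hint' g), h g hg, h' g hg]
    simp
  have him := ae_eq_zero_of_integral_trig hQ hx.im fun g hg => by
    have : ∀ ξ, ((RCLike.im (x ξ) : ℝ) : ℂ) * trig g ξ =
        (1 / (2 * Complex.I) : ℂ) * (x ξ * trig g ξ - starRingEnd ℂ (x ξ) * trig g ξ) := fun ξ => by
      rw [← sub_mul, Complex.sub_conj]; field_simp; simp; ring
    simp only [this]
    rw [integral_const_mul, integral_sub (hint g) (hint' g), h g hg, h' g hg]
    simp
  filter_upwards [hre, him] with ξ h1 h2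
  exact Complex.ext h1 h2

namespace IsPoissonProcess

/-- A ν-integrable simple function is bounded and supported in a set of finite intensity, so the
weight |g| in `norm_covariance_trig_le` is at most a constant times an indicator to which `hD`
applies. -/
lemma tendsto_covariance_trig [IsProbabilityMeasure P] [SigmaFinite ν]
    (hη : IsPoissonProcess η ν P) {H : ℕ → Measure Z → ℂ} (hH : ∀ n, Measurable (H n))
    (hH1 : ∀ n ξ, ‖H n ξ‖ ≤ 1)
    (hD : ∀ A, MeasurableSet A → ν A < ∞ →
      Tendsto (fun n => ∫⁻ ω, ∫⁻ z in A, ‖addOp (H n) (η ω) z‖ₑ ∂ν ∂P) atTop (𝓝 0))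
    {g : SimpleFunc Z ℝ} (hg : Integrable g ν) :
    Tendsto (fun n => ∫ ω, H n (η ω) * trig g (η ω) ∂P -
      (∫ ω, H n (η ω) ∂P) * ∫ ω, trig g (η ω) ∂P) atTop (𝓝 0) := by
  obtain ⟨M, hM⟩ := g.exists_forall_norm_le
  have hA : ν (Function.support g) < ∞ :=
    SimpleFunc.finMeasSupp_iff_support.1 (SimpleFunc.integrable_iff_finMeasSupp.1 hg)
  have hms : MeasurableSet (Function.support g) := g.measurableSet_support
  have hmeas : ∀ n, Measurable fun p : Ω × Z => addOp (H n) (η p.1) p.2 := fun n =>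
    ((hH n).comp hη.measurable_add_dirac).sub ((hH n).comp (hη.measurable.comp measurable_fst))
  have hgm := g.measurable
  have hbd : ∀ n, ∫⁻ p, ‖|g p.2| * ‖addOp (H n) (η p.1) p.2‖‖ₑ ∂(P.prod ν) ≤
      ENNReal.ofReal M *
        ∫⁻ ω, ∫⁻ z in Function.support g, ‖addOp (H n) (η ω) z‖ₑ ∂ν ∂P := by
    intro n
    have hn := hmeas n
    rw [lintegral_prod _ (Measurable.aemeasurable (by fun_prop)),
      ← lintegral_const_mul' _ _ ENNReal.ofReal_ne_top]
    refine lintegral_mono fun ω => ?_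
    rw [← lintegral_indicator hms, ← lintegral_const_mul' _ _ ENNReal.ofReal_ne_top]
    refine lintegral_mono fun z => ?_
    by_cases hz : z ∈ Function.support g
    · rw [Set.indicator_of_mem hz]
      rw [enorm_mul, enorm_norm]
      gcongr
      rw [← ofReal_norm]
      exact ENNReal.ofReal_le_ofReal (by simpa using hM z)
    · have : g z = 0 := by simpa using hz
      simp [this]
  have hlim : Tendsto (fun n => ∫⁻ p, ‖|g p.2| * ‖addOp (H n) (η p.1) p.2‖‖ₑ ∂(P.prod ν))
      atTop (𝓝 0) := by
    have := ENNReal.Tendsto.const_mul (hD _ hms hA) (Or.inr (ENNReal.ofReal_ne_top (r := M)))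
    rw [mul_zero] at this
    exact tendsto_of_tendsto_of_tendsto_of_le_of_le tendsto_const_nhds this (fun _ => zero_le)
      hbd
  have hlim2 : Tendsto (fun n => ∫ p, |g p.2| * ‖addOp (H n) (η p.1) p.2‖ ∂(P.prod ν))
      atTop (𝓝 0) := by
    have h0 := (ENNReal.tendsto_toReal (by simp)).comp hlim
    refine h0.congr fun n => ?_
    have hn := hmeas n
    rw [Function.comp_apply, ← integral_norm_eq_lintegral_enorm
      (Measurable.aestronglyMeasurable (by fun_prop))]
    exact integral_congr_ae (ae_of_all _ fun p => by simp)
  refine squeeze_zero_norm (fun n => hη.norm_covariance_trig_le hg (hH n) (hH1 n)) ?_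
  simpa using hlim2.mul_const _

/-- A sequence of bounded functionals whose add derivatives vanish locally is mixing:
it is asymptotically independent of the point process. -/
theorem tendsto_covariance [IsProbabilityMeasure P] [SigmaFinite ν]
    (hη : IsPoissonProcess η ν P) {H : ℕ → Measure Z → ℂ} (hH : ∀ n, Measurable (H n))
    (hH1 : ∀ n ξ, ‖H n ξ‖ ≤ 1)
    (hD : ∀ A, MeasurableSet A → ν A < ∞ →
      Tendsto (fun n => ∫⁻ ω, ∫⁻ z in A, ‖addOp (H n) (η ω) z‖ₑ ∂ν ∂P) atTop (𝓝 0))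
    {V : Measure Z → ℂ} (hV : Measurable V) (hV1 : ∀ ξ, ‖V ξ‖ ≤ 1) :
    Tendsto (fun n => ∫ ω, H n (η ω) * V (η ω) ∂P -
      (∫ ω, H n (η ω) ∂P) * ∫ ω, V (η ω) ∂P) atTop (𝓝 0) := by
  have : IsProbabilityMeasure (P.map η) :=
    Measure.isProbabilityMeasure_map hη.measurable.aemeasurable
  set Q := P.map η with hQ
  have hmapint : ∀ {G : Measure Z → ℂ}, Measurable G → ∫ ξ, G ξ ∂Q = ∫ ω, G (η ω) ∂P :=
    fun hG => integral_map hη.measurable.aemeasurable hG.aestronglyMeasurable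
  set c : ℕ → ℂ := fun n => ∫ ω, H n (η ω) ∂P
  have hc1 : ∀ n, ‖c n‖ ≤ 1 := fun n => by
    refine (norm_integral_le_of_norm_le_const (C := 1) (ae_of_all _ fun ω => hH1 n _)).trans ?_
    simp
  -- The vectors tested in L² of the law of `η` are the conjugates of H_n - E H_n. The conjugation
  -- undoes that of the first slot of the inner product, so pairing with `W` is exactly the
  -- covariance.
  have hbd : ∀ n ξ, ‖starRingEnd ℂ (H n ξ - c n)‖ ≤ 2 := fun n ξ => by
    rw [RCLike.norm_conj]
    exact (norm_sub_le _ _).trans (by linarith [hH1 n ξ, hc1 n])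
  have hmX : ∀ n, Measurable fun ξ => starRingEnd ℂ (H n ξ - c n) := fun n =>
    Complex.continuous_conj.measurable.comp ((hH n).sub_const _)
  have hX2 : ∀ n, MemLp (fun ξ => starRingEnd ℂ (H n ξ - c n)) 2 Q := fun n =>
    MemLp.of_bound (hmX n).aestronglyMeasurable 2 (ae_of_all _ (hbd n))
  have hV2 : ∀ {W : Measure Z → ℂ}, Measurable W → (∀ ξ, ‖W ξ‖ ≤ 1) → MemLp W 2 Q := fun hW hW1 =>
    MemLp.of_bound hW.aestronglyMeasurable 1 (ae_of_all _ hW1)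
  have hinner : ∀ n {W : Measure Z → ℂ} (hW : Measurable W) (hW1 : ∀ ξ, ‖W ξ‖ ≤ 1),
      inner ℂ ((hX2 n).toLp _) ((hV2 hW hW1).toLp _) = ∫ ω, H n (η ω) * W (η ω) ∂P -
        c n * ∫ ω, W (η ω) ∂P := by
    intro n W hW hW1
    rw [L2.inner_def]
    have h1 : ∫ ξ, inner ℂ ((hX2 n).toLp _ ξ) ((hV2 hW hW1).toLp _ ξ) ∂Q =
        ∫ ξ, (H n ξ * W ξ - c n * W ξ) ∂Q := by
      refine integral_congr_ae ?_
      filter_upwards [(hX2 n).coeFn_toLp, (hV2 hW hW1).coeFn_toLp] with ξ h1 h2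
      rw [h1, h2]
      simp
      ring
    have hW1' : ∀ ω, ‖W (η ω)‖ ≤ 1 := fun ω => hW1 _
    have hWm := hW.comp hη.measurable
    have h2 : Measurable fun ξ => H n ξ * W ξ - c n * W ξ :=
      ((hH n).mul hW).sub (hW.const_mul _)
    rw [h1, hmapint h2, integral_sub, integral_const_mul]
    · refine Integrable.of_bound (C := 1)
        (((hH n).comp hη.measurable).mul hWm).aestronglyMeasurable (ae_of_all _ fun ω => ?_)
      rw [norm_mul]
      exact mul_le_one₀ (hH1 n _) (norm_nonneg _) (hW1 _)
    · exact (Integrable.of_bound (C := 1) hWm.aestronglyMeasurable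
        (ae_of_all _ fun ω => hW1 _)).const_mul _
  rw [← funext fun n => hinner n hV hV1]
  refine tendsto_inner_zero_of_total (C := 2) (fun n => ?_)
    {v | ∃ g : SimpleFunc Z ℝ, Integrable g ν ∧
      v = (hV2 (measurable_trig g) (fun ξ => (norm_trig g ξ).le)).toLp _} ?_ ?_ _
  · refine (Lp.norm_le_of_ae_bound (C := 2) (by norm_num) ?_).trans ?_
    · filter_upwards [(hX2 n).coeFn_toLp] with ξ h1
      rw [h1]
      exact hbd n ξ
    · simp [measureUnivNNReal]
  · rintro _ ⟨g, hg, rfl⟩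
    exact (hη.tendsto_covariance_trig hH hH1 hD hg).congr fun n => (hinner n (measurable_trig g)
      fun ξ => (norm_trig g ξ).le).symm
  · intro x hx
    have hxint : Integrable x Q := (Lp.memLp x).integrable (by norm_num)
    have hzero := ae_eq_zero_of_integral_trig_complex hη.aeLocallyFinite hxint fun g hg => by
      have hg' : Integrable (-g : SimpleFunc Z ℝ) ν := by simpa using hg.neg
      -- Orthogonality is used at `-g`, since the inner product conjugates `trig (-g)` into `trig
      -- g`.
      have h1 := hx _ ⟨-g, hg', rfl⟩
      rw [L2.inner_def] at h1
      rw [← h1]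
      refine integral_congr_ae ?_
      filter_upwards [(hV2 (measurable_trig (-g)) (fun ξ => (norm_trig (-g) ξ).le)).coeFn_toLp,
        hη.aeLocallyFinite.ae_integrable hg] with ξ h2 h3
      rw [h2, ← conj_trig h3]
      simp
    exact (Lp.eq_zero_iff_ae_eq_zero).2 hzero

end IsPoissonProcess
end Mixing

/-! ### Uniform Taylor estimates for the interpolating function. -/

section Taylor

variable {E : Type*} [NormedAddCommGroup E]

/-- The Gaussian weight `exp (-κ |b|² / 2)`. -/
noncomputable def gaussWeight (κ : ℝ) (b : E) : ℝ := Real.exp (-(κ / 2) * ‖b‖ ^ 2)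

lemma gaussWeight_pos (κ : ℝ) (b : E) : 0 < gaussWeight κ b := Real.exp_pos _

lemma gaussWeight_le_one {κ : ℝ} (h0 : 0 ≤ κ) (b : E) : gaussWeight κ b ≤ 1 := by
  rw [gaussWeight, Real.exp_le_one_iff]
  have : 0 ≤ κ / 2 * ‖b‖ ^ 2 := by positivity
  linarith

/-- For κ ≤ 1, κ|b| ≤ 1 + κ|b|²/2 ≤ exp(κ|b|²/2). This bounds the gradient of the weight uniformly
in `b` and `κ`. -/
lemma norm_mul_gaussWeight_le {κ : ℝ} (h0 : 0 ≤ κ) (h1 : κ ≤ 1) (b : E) :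
    κ * ‖b‖ * gaussWeight κ b ≤ 1 := by
  have h2 := Real.add_one_le_exp (κ / 2 * ‖b‖ ^ 2)
  have h3 : κ * ‖b‖ ≤ Real.exp (κ / 2 * ‖b‖ ^ 2) := by
    nlinarith [sq_nonneg (κ * ‖b‖ - 1), mul_nonneg (mul_nonneg h0 (sub_nonneg.2 h1)) (sq_nonneg ‖b‖)]
  calc κ * ‖b‖ * gaussWeight κ b
      ≤ Real.exp (κ / 2 * ‖b‖ ^ 2) * gaussWeight κ b := by
        gcongr; exact (gaussWeight_pos κ b).le
    _ = 1 := by rw [gaussWeight, ← Real.exp_add]; simp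

/-- The same comparison with the exponential, now for the factor that bounds the second derivative
of the weight. -/
lemma sq_mul_gaussWeight_le {κ : ℝ} (h0 : 0 ≤ κ) (h1 : κ ≤ 1) (b : E) :
    (κ ^ 2 * ‖b‖ ^ 2 + κ) * gaussWeight κ b ≤ 2 := by
  have h2 := Real.add_one_le_exp (κ / 2 * ‖b‖ ^ 2)
  have h3 : κ ^ 2 * ‖b‖ ^ 2 + κ ≤ 2 * Real.exp (κ / 2 * ‖b‖ ^ 2) := by
    nlinarith [mul_nonneg (mul_nonneg h0 (sub_nonneg.2 h1)) (sq_nonneg ‖b‖)]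
  calc (κ ^ 2 * ‖b‖ ^ 2 + κ) * gaussWeight κ b
      ≤ 2 * Real.exp (κ / 2 * ‖b‖ ^ 2) * gaussWeight κ b := by
        gcongr; exact (gaussWeight_pos κ b).le
    _ = 2 := by rw [gaussWeight, mul_assoc, ← Real.exp_add]; simp

/-- The interpolation `exp (i r a) exp (- (1 - r²) |b|² / 2)`. -/
noncomputable def interp (r a : ℝ) (b : E) : ℂ :=
  Complex.exp ((r * a : ℝ) * Complex.I) * gaussWeight (1 - r ^ 2) b

lemma norm_interp_le {r : ℝ} (hr : r ^ 2 ≤ 1) (a : ℝ) (b : E) : ‖interp r a b‖ ≤ 1 := by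
  rw [interp, norm_mul, Complex.norm_exp_ofReal_mul_I, one_mul, Complex.norm_real,
    Real.norm_of_nonneg (gaussWeight_pos _ _).le]
  exact gaussWeight_le_one (by linarith) b

lemma norm_exp_sub_one_le (x : ℝ) : ‖Complex.exp (x * Complex.I) - 1‖ ≤ |x| := by
  simpa [mul_comm] using Real.norm_exp_I_mul_ofReal_sub_one_le (x := x)

/-- For |x| ≤ 1 this is the second-order bound on the exponential; for |x| ≥ 1 the crude bound 2|x|
suffices. -/
lemma norm_exp_sub_one_sub_le (x : ℝ) :
    ‖Complex.exp (x * Complex.I) - 1 - x * Complex.I‖ ≤ 2 * x ^ 2 := by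
  have : ‖(x : ℂ) * Complex.I‖ = |x| := by simp
  rcases le_total |x| 1 with h | h
  · refine (Complex.norm_exp_sub_one_sub_id_le (by simpa using h)).trans ?_
    rw [this, sq_abs]
    linarith [sq_nonneg x]
  · refine (norm_sub_le _ _).trans ?_
    rw [this, ← sq_abs]
    nlinarith [norm_exp_sub_one_le x]

lemma interp_add (r a α : ℝ) (b : E) (β : E) : interp r (a + α) (b + β) =
    Complex.exp ((r * a : ℝ) * Complex.I) * (Complex.exp ((r * α : ℝ) * Complex.I) *
      gaussWeight (1 - r ^ 2) (b + β)) := by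
  rw [interp, ← mul_assoc, ← Complex.exp_add]
  push_cast
  ring_nf

lemma measurable_interp [MeasurableSpace E] [BorelSpace E] (r : ℝ) :
    Measurable fun p : ℝ × E => interp r p.1 p.2 := by
  unfold interp gaussWeight
  fun_prop

/-- The exponent 1 - r² is chosen so that the weight contributes r|b|², with the same factor r that
differentiating exp(ira) in `a` produces after duality. -/
lemma hasDerivAt_interp (a : ℝ) (b : E) (r : ℝ) :
    HasDerivAt (fun r => interp r a b) ((a * Complex.I + (r * ‖b‖ ^ 2 : ℝ)) * interp r a b) r := by
  have h1 : HasDerivAt (fun r : ℝ => Complex.exp ((r * a : ℝ) * Complex.I)) _ r :=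
    ((((hasDerivAt_id r).mul_const a).ofReal_comp).mul_const Complex.I).cexp
  have h2 : HasDerivAt (fun r : ℝ => ((gaussWeight (1 - r ^ 2) b : ℝ) : ℂ)) _ r :=
    ((((((hasDerivAt_id r).pow 2).const_sub 1).div_const 2).neg.mul_const (‖b‖ ^ 2)).exp).ofReal_comp
  convert! h1.mul h2 using 1
  simp only [interp, gaussWeight, id, Pi.neg_apply, Pi.pow_apply]
  push_cast
  ring

variable [InnerProductSpace ℝ E]

lemma hasDerivAt_gaussWeight_line (κ : ℝ) (b β : E) (t : ℝ) :
    HasDerivAt (fun t : ℝ => gaussWeight κ (b + t • β))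
      (-(κ * inner ℝ (b + t • β) β) * gaussWeight κ (b + t • β)) t := by
  have h1 : HasDerivAt (fun t : ℝ => b + t • β) ((1 : ℝ) • β) t :=
    ((hasDerivAt_id t).smul_const β).const_add b
  have h2 := (h1.norm_sq.const_mul (-(κ / 2))).exp
  convert! h2 using 1
  simp only [gaussWeight, one_smul]
  ring

lemma abs_gaussWeight_sub_le {κ : ℝ} (h0 : 0 ≤ κ) (h1 : κ ≤ 1) (b β : E) :
    |gaussWeight κ (b + β) - gaussWeight κ b| ≤ ‖β‖ := by
  have := norm_image_sub_le_of_norm_deriv_le_segment_01'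
    (f := fun t : ℝ => gaussWeight κ (b + t • β)) (C := ‖β‖)
    (fun t _ => (hasDerivAt_gaussWeight_line κ b β t).hasDerivWithinAt) (fun t _ => by
      rw [norm_mul, norm_neg, norm_mul, Real.norm_of_nonneg h0,
        Real.norm_of_nonneg (gaussWeight_pos _ _).le]
      have hin := norm_inner_le_norm (𝕜 := ℝ) (b + t • β) β
      have hg := norm_mul_gaussWeight_le h0 h1 (b + t • β)
      calc κ * ‖inner ℝ (b + t • β) β‖ * gaussWeight κ (b + t • β)
          ≤ κ * (‖b + t • β‖ * ‖β‖) * gaussWeight κ (b + t • β) := by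
            gcongr; exact (gaussWeight_pos κ _).le
        _ = ‖β‖ * (κ * ‖b + t • β‖ * gaussWeight κ (b + t • β)) := by ring
        _ ≤ ‖β‖ * 1 := by gcongr
        _ = ‖β‖ := mul_one _)
  simpa using this

/-- Along the segment the second derivative is at most 2|β|² by `sq_mul_gaussWeight_le`. The mean
value inequality is applied to `q'`, then to `t ↦ q t - t * q' 0`; this costs the factor 1/2 of the
Taylor formula. -/
lemma abs_gaussWeight_taylor_le {κ : ℝ} (h0 : 0 ≤ κ) (h1 : κ ≤ 1) (b β : E) :
    |gaussWeight κ (b + β) - gaussWeight κ b + κ * inner ℝ b β * gaussWeight κ b|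
      ≤ 2 * ‖β‖ ^ 2 := by
  set q := fun t : ℝ => gaussWeight κ (b + t • β) with hq
  set q' := fun t : ℝ => -(κ * inner ℝ (b + t • β) β) * q t with hq'
  have hd : ∀ t, HasDerivAt q (q' t) t := hasDerivAt_gaussWeight_line κ b β
  have hd2 : ∀ t, HasDerivAt q' (-(κ * ‖β‖ ^ 2) * q t + -(κ * inner ℝ (b + t • β) β) * q' t) t := by
    intro t
    have h1 : HasDerivAt (fun t : ℝ => b + t • β) ((1 : ℝ) • β) t :=
      ((hasDerivAt_id t).smul_const β).const_add b
    have h2 := (((h1.inner ℝ (hasDerivAt_const t β)).const_mul κ).neg).mul (hd t)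
    convert! h2 using 1
    simp [hq']
  have hb2 : ∀ t, ‖-(κ * ‖β‖ ^ 2) * q t + -(κ * inner ℝ (b + t • β) β) * q' t‖ ≤ 2 * ‖β‖ ^ 2 := by
    intro t
    have hqp : 0 < q t := gaussWeight_pos _ _
    have hg := sq_mul_gaussWeight_le h0 h1 (b + t • β)
    have hin : (inner ℝ (b + t • β) β) ^ 2 ≤ ‖b + t • β‖ ^ 2 * ‖β‖ ^ 2 := by
      rw [← mul_pow, ← sq_abs]
      gcongr
      exact norm_inner_le_norm (𝕜 := ℝ) (b + t • β) β
    have e : -(κ * ‖β‖ ^ 2) * q t + -(κ * inner ℝ (b + t • β) β) * q' t =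
        -(κ * ‖β‖ ^ 2 * q t) + κ ^ 2 * (inner ℝ (b + t • β) β) ^ 2 * q t := by
      simp only [hq']; ring
    rw [e]
    refine (norm_add_le _ _).trans ?_
    rw [norm_neg, Real.norm_of_nonneg (by positivity), Real.norm_of_nonneg (by positivity)]
    calc κ * ‖β‖ ^ 2 * q t + κ ^ 2 * (inner ℝ (b + t • β) β) ^ 2 * q t
        ≤ κ * ‖β‖ ^ 2 * q t + κ ^ 2 * (‖b + t • β‖ ^ 2 * ‖β‖ ^ 2) * q t := by gcongr
      _ = ((κ ^ 2 * ‖b + t • β‖ ^ 2 + κ) * q t) * ‖β‖ ^ 2 := by ring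
      _ ≤ 2 * ‖β‖ ^ 2 := by gcongr
  have hb1 : ∀ t ∈ Set.Icc (0 : ℝ) 1, ‖q' t - q' 0‖ ≤ 2 * ‖β‖ ^ 2 := by
    intro t ht
    have := norm_image_sub_le_of_norm_deriv_le_segment'
      (fun s (_ : s ∈ Set.Icc (0 : ℝ) 1) => (hd2 s).hasDerivWithinAt) (fun s _ => hb2 s) t ht
    refine this.trans ?_
    rw [sub_zero]
    exact mul_le_of_le_one_right (by positivity) ht.2
  have := norm_image_sub_le_of_norm_deriv_le_segment_01' (f := fun t => q t - t * q' 0)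
    (C := 2 * ‖β‖ ^ 2)
    (fun t _ => ((hd t).sub ((hasDerivAt_id t).mul_const (q' 0))).hasDerivWithinAt)
    (fun t ht => by simpa only [one_mul] using hb1 t (Set.Ico_subset_Icc_self ht))
  simp only [hq, hq', one_smul, zero_smul, add_zero, Real.norm_eq_abs, zero_mul, sub_zero] at this
  convert! this using 2
  ring

lemma norm_interp_sub_le {r : ℝ} (h0 : 0 ≤ r) (hr : r ≤ 1) (a α : ℝ) (b β : E) :
    ‖interp r (a + α) (b + β) - interp r a b‖ ≤ |α| + ‖β‖ := by
  have hr2 : r ^ 2 ≤ 1 := by nlinarith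
  have h1 : interp r (a + α) (b + β) - interp r a b = Complex.exp ((r * a : ℝ) * Complex.I) *
      ((Complex.exp ((r * α : ℝ) * Complex.I) - 1) * gaussWeight (1 - r ^ 2) (b + β) +
        ((gaussWeight (1 - r ^ 2) (b + β) - gaussWeight (1 - r ^ 2) b : ℝ) : ℂ)) := by
    rw [interp_add, interp]; push_cast; ring
  rw [h1, norm_mul, Complex.norm_exp_ofReal_mul_I, one_mul]
  refine (norm_add_le _ _).trans (add_le_add ?_ ?_)
  · rw [norm_mul, Complex.norm_real, Real.norm_of_nonneg (gaussWeight_pos _ _).le]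
    have h2 := norm_exp_sub_one_le (r * α)
    have h3 : |r * α| ≤ |α| := by
      rw [abs_mul, abs_of_nonneg h0]; exact mul_le_of_le_one_left (abs_nonneg _) hr
    exact (mul_le_of_le_one_right (norm_nonneg _) (gaussWeight_le_one (by linarith) _)).trans
      (h2.trans h3)
  · rw [Complex.norm_real]
    exact abs_gaussWeight_sub_le (by linarith) (by nlinarith) b β

/-- The remainder is the sum of the remainder of the exponential, a product of two first-order
increments, and the remainder of the weight. These are at most 2α², |α||β| and 2|β|², whence the 3.
The bound is uniform in `a`, `b` and `r`. -/
lemma norm_interp_taylor_le {r : ℝ} (h0 : 0 ≤ r) (hr : r ≤ 1) (a α : ℝ) (b β : E) :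
    ‖interp r (a + α) (b + β) - interp r a b - interp r a b *
      ((r * α : ℝ) * Complex.I - ((1 - r ^ 2) * inner ℝ b β : ℝ))‖ ≤ 3 * (α ^ 2 + ‖β‖ ^ 2) := by
  have hr2 : r ^ 2 ≤ 1 := by nlinarith
  set κ := 1 - r ^ 2 with hκ
  have hκ0 : 0 ≤ κ := by linarith
  have hκ1 : κ ≤ 1 := by nlinarith
  have h1 : interp r (a + α) (b + β) - interp r a b - interp r a b *
      ((r * α : ℝ) * Complex.I - (κ * inner ℝ b β : ℝ)) =
      Complex.exp ((r * a : ℝ) * Complex.I) *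
      ((Complex.exp ((r * α : ℝ) * Complex.I) - 1 - (r * α : ℝ) * Complex.I) * gaussWeight κ b +
        (Complex.exp ((r * α : ℝ) * Complex.I) - 1) *
          ((gaussWeight κ (b + β) - gaussWeight κ b : ℝ) : ℂ) +
        ((gaussWeight κ (b + β) - gaussWeight κ b + κ * inner ℝ b β * gaussWeight κ b : ℝ) : ℂ)) := by
    rw [interp_add, interp]; push_cast; ring
  rw [h1, norm_mul, Complex.norm_exp_ofReal_mul_I, one_mul]
  have h3 : |r * α| ≤ |α| := by
    rw [abs_mul, abs_of_nonneg h0]; exact mul_le_of_le_one_left (abs_nonneg _) hr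
  have h4 : (r * α) ^ 2 ≤ α ^ 2 := sq_le_sq.2 h3
  have e1 : ‖(Complex.exp ((r * α : ℝ) * Complex.I) - 1 - (r * α : ℝ) * Complex.I) *
      gaussWeight κ b‖ ≤ 2 * α ^ 2 := by
    rw [norm_mul, Complex.norm_real, Real.norm_of_nonneg (gaussWeight_pos _ _).le]
    exact (mul_le_of_le_one_right (norm_nonneg _) (gaussWeight_le_one hκ0 _)).trans
      ((norm_exp_sub_one_sub_le _).trans (by linarith))
  have e2 : ‖(Complex.exp ((r * α : ℝ) * Complex.I) - 1) *
      ((gaussWeight κ (b + β) - gaussWeight κ b : ℝ) : ℂ)‖ ≤ |α| * ‖β‖ := by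
    rw [norm_mul, Complex.norm_real]
    exact mul_le_mul ((norm_exp_sub_one_le _).trans h3) (abs_gaussWeight_sub_le hκ0 hκ1 b β)
      (norm_nonneg _) (abs_nonneg _)
  have e3 := abs_gaussWeight_taylor_le hκ0 hκ1 b β
  rw [← Real.norm_eq_abs, ← Complex.norm_real] at e3
  refine (norm_add_le _ _).trans ((add_le_add (norm_add_le _ _) le_rfl).trans ?_)
  have := two_mul_le_add_sq |α| ‖β‖
  rw [sq_abs] at this
  linarith [sq_nonneg α, sq_nonneg ‖β‖]

end Taylor

lemma memLp_two_of_lintegral_lt_top {X F : Type*} [MeasurableSpace X] [NormedAddCommGroup F]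
    {μ : Measure X} {f : X → F} (hf : AEStronglyMeasurable f μ) (h : ∫⁻ x, ‖f x‖ₑ ^ 2 ∂μ < ∞) :
    MemLp f 2 μ := by
  refine ⟨hf, ?_⟩
  rw [eLpNorm_lt_top_iff_lintegral_rpow_enorm_lt_top (by norm_num) (by norm_num)]
  simpa using h

lemma lintegral_lt_top_of_memLp_two {X F : Type*} [MeasurableSpace X] [NormedAddCommGroup F]
    {μ : Measure X} {f : X → F} (h : MemLp f 2 μ) : ∫⁻ x, ‖f x‖ₑ ^ 2 ∂μ < ∞ := by
  have := (eLpNorm_lt_top_iff_lintegral_rpow_enorm_lt_top (by norm_num) (by norm_num)).1 h.2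
  simpa using this

/-! ### Duality and the interpolation bound. -/

section Interpolation

variable {Ω Z : Type*} [MeasurableSpace Ω] [MeasurableSpace Z] {P : Measure Ω}
  {ν : Measure Z} {η : Ω → Measure Z}

lemma ae_memLp_two_slice {F : Type*} [NormedAddCommGroup F] [MeasurableSpace F] [BorelSpace F]
    [SecondCountableTopology F] [SigmaFinite ν] {f : Ω × Z → F}
    (hf : Measurable f) (h : ∫⁻ ω, ∫⁻ z, ‖f (ω, z)‖ₑ ^ 2 ∂ν ∂P < ∞) :
    ∀ᵐ ω ∂P, MemLp (fun z => f (ω, z)) 2 ν := by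
  have hm : Measurable fun ω => ∫⁻ z, ‖f (ω, z)‖ₑ ^ 2 ∂ν :=
    Measurable.lintegral_prod_right' (f := fun p => ‖f p‖ₑ ^ 2) (by fun_prop)
  filter_upwards [ae_lt_top hm h.ne] with ω hω
  exact memLp_two_of_lintegral_lt_top
    (hf.comp measurable_prodMk_left).aestronglyMeasurable hω

lemma IsPoissonProcess.measurable_addOp (hη : IsPoissonProcess η ν P) {F : Type*}
    [NormedAddCommGroup F] [MeasurableSpace F] [BorelSpace F] [SecondCountableTopology F]
    {G : Measure Z → F} (hG : Measurable G) :
    Measurable fun p : Ω × Z => addOp G (η p.1) p.2 :=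
  (hG.comp hη.measurable_add_dirac).sub (hG.comp (hη.measurable.comp measurable_fst))

lemma IsDelta.measurable_comp (hη : IsPoissonProcess η ν P) {w : Measure Z → Z → ℝ}
    {A : Measure Z → ℝ} (hw : IsDelta η ν P w A) :
    Measurable fun p : Ω × Z => w (η p.1) p.2 :=
  hw.dom.measurable.comp ((hη.measurable.comp measurable_fst).prodMk measurable_snd)

/-- The duality between `D` and `δ` for bounded complex functionals. -/
lemma IsDelta.duality_complex [SigmaFinite ν] [IsProbabilityMeasure P] (hη : IsPoissonProcess η ν P)
    {w : Measure Z → Z → ℝ} {A : Measure Z → ℝ} (hw : IsDelta η ν P w A) {G : Measure Z → ℂ}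
    (hG : Measurable G) (hG1 : ∀ ξ, ‖G ξ‖ ≤ 1)
    (hD : ∫⁻ ω, ∫⁻ z, ‖addOp G (η ω) z‖ₑ ^ 2 ∂ν ∂P < ∞) :
    Integrable (fun p : Ω × Z => (w (η p.1) p.2 : ℂ) * addOp G (η p.1) p.2) (P.prod ν) ∧
    ∫ ω, (A (η ω) : ℂ) * G (η ω) ∂P =
      ∫ p, (w (η p.1) p.2 : ℂ) * addOp G (η p.1) p.2 ∂(P.prod ν) := by
  have hGm := hη.measurable_addOp hG
  have hwm := hw.measurable_comp hη
  have hD2 : MemLp (fun p : Ω × Z => addOp G (η p.1) p.2) 2 (P.prod ν) := by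
    refine memLp_two_of_lintegral_lt_top hGm.aestronglyMeasurable ?_
    rwa [lintegral_prod _ (Measurable.aemeasurable (by fun_prop))]
  have hint : Integrable (fun p : Ω × Z => (w (η p.1) p.2 : ℂ) * addOp G (η p.1) p.2)
      (P.prod ν) := hw.dom.memLp.ofReal.integrable_mul hD2
  refine ⟨hint, ?_⟩
  -- Duality is available for real functionals only. It is applied to L ∘ G for the contractions L =
  -- Re and L = Im, under which membership in the domain of D is preserved.
  have hdom : ∀ L : ℂ →L[ℝ] ℝ, (∀ x, ‖L x‖ ≤ ‖x‖) → MemDomD η ν P (fun ξ => L (G ξ)) := by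
    intro L hL
    refine ⟨L.measurable.comp hG, ?_, ?_⟩
    · exact MemLp.of_bound (L.measurable.comp (hG.comp hη.measurable)).aestronglyMeasurable 1
        (ae_of_all _ fun ω => (hL _).trans (hG1 _))
    · refine lt_of_le_of_lt ?_ hD
      refine lintegral_mono fun ω => lintegral_mono fun z => ?_
      simp only
      have : addOp (fun ξ => L (G ξ)) (η ω) z = L (addOp G (η ω) z) := by simp [addOp]
      rw [this]
      gcongr
      exact enorm_le_iff_norm_le.2 (hL _)
  have hintA : Integrable (fun ω => (A (η ω) : ℂ) * G (η ω)) P :=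
    (hw.memLp.integrable (by norm_num)).ofReal.mul_bdd (c := 1)
      (hG.comp hη.measurable).aestronglyMeasurable (ae_of_all _ fun ω => hG1 _)
  have key : ∀ L : ℂ →L[ℝ] ℝ, (∀ x, ‖L x‖ ≤ ‖x‖) →
      ∫ ω, L ((A (η ω) : ℂ) * G (η ω)) ∂P =
        ∫ p, L ((w (η p.1) p.2 : ℂ) * addOp G (η p.1) p.2) ∂(P.prod ν) := by
    intro L hL
    have h1 := hw.duality _ (hdom L hL)
    rw [integral_prod _ (L.integrable_comp hint)]
    have e : ∀ (x : ℝ) (y : ℂ), L ((x : ℂ) * y) = x * L y := fun x y => by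
      rw [← Complex.real_smul, map_smul, smul_eq_mul]
    simp only [e]
    convert! h1 using 1
    · exact integral_congr_ae (ae_of_all _ fun ω => mul_comm _ _)
    · simp only [addOp, map_sub]
  rw [← integral_re_add_im hintA, ← integral_re_add_im hint]
  have h1 := key Complex.reCLM Complex.abs_re_le_norm
  have h2 := key Complex.imCLM Complex.abs_im_le_norm
  simp only [Complex.reCLM_apply, Complex.imCLM_apply] at h1 h2
  simp only [RCLike.re_eq_complex_re, RCLike.im_eq_complex_im, h1, h2]

variable {d : ℕ}

/-- Continuity up to r = 1 complements `hasDerivAt_integral_interp`, which stops short of that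
endpoint. -/
lemma continuousOn_integral_interp [IsProbabilityMeasure P] {a : Ω → ℝ} {b : Ω → Vec d}
    (ha : Measurable a) (hb : Measurable b) :
    ContinuousOn (fun r : ℝ => ∫ ω, interp r (a ω) (b ω) ∂P) (Set.Icc 0 1) := by
  refine continuousOn_of_dominated (bound := fun _ => 1)
    (fun r _ => ((measurable_interp r).comp (ha.prodMk hb)).aestronglyMeasurable)
    (fun r hr => ae_of_all _ fun ω => norm_interp_le (by nlinarith [hr.1, hr.2]) _ _)
    (integrable_const _)
    (ae_of_all _ fun ω r _ => (hasDerivAt_interp (a ω) (b ω) r).continuousAt.continuousWithinAt)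

/-- Differentiation under the integral needs a neighbourhood of r on which the weight is at most 1.
It is so when r² ≤ 1, hence the interval (-1, 1) and the condition `r < 1`. -/
lemma hasDerivAt_integral_interp [IsProbabilityMeasure P] {a : Ω → ℝ} {b : Ω → Vec d}
    (ha : Measurable a) (hb : Measurable b) (ha2 : MemLp a 2 P) (hb2 : MemLp b 2 P) {r : ℝ}
    (h0 : 0 ≤ r) (h1 : r < 1) :
    HasDerivAt (fun r : ℝ => ∫ ω, interp r (a ω) (b ω) ∂P)
      (∫ ω, (a ω * Complex.I + (r * ‖b ω‖ ^ 2 : ℝ)) * interp r (a ω) (b ω) ∂P) r := by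
  have hm : ∀ r, Measurable fun ω => interp r (a ω) (b ω) :=
    fun r => (measurable_interp r).comp (ha.prodMk hb)
  have hmr := hm r
  refine (hasDerivAt_integral_of_dominated_loc_of_deriv_le
    (s := Set.Ioo (-1) 1) (bound := fun ω => |a ω| + ‖b ω‖ ^ 2)
    (Ioo_mem_nhds (by linarith) h1)
    (Eventually.of_forall fun r => (hm r).aestronglyMeasurable)
    (Integrable.of_bound (C := 1) hmr.aestronglyMeasurable
      (ae_of_all _ fun ω => norm_interp_le (by nlinarith) _ _))
    (Measurable.aestronglyMeasurable (by fun_prop))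
    (ae_of_all _ fun ω t ht => ?_)
    ((ha2.integrable (by norm_num)).abs.add hb2.integrable_norm_pow')
    (ae_of_all _ fun ω t _ => hasDerivAt_interp (a ω) (b ω) t)).2
  have ht2 : t ^ 2 ≤ 1 := by nlinarith [ht.1, ht.2]
  rw [norm_mul]
  refine (mul_le_of_le_one_right (norm_nonneg _) (norm_interp_le ht2 _ _)).trans ?_
  refine (norm_add_le _ _).trans (add_le_add (by simp) ?_)
  rw [Complex.norm_real, norm_mul, Real.norm_of_nonneg (by positivity : 0 ≤ ‖b ω‖ ^ 2)]
  exact mul_le_of_le_one_left (by positivity) (abs_le.2 ⟨ht.1.le, ht.2.le⟩)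

/-- Pointwise expansion of the derivative of the interpolation. -/
lemma enorm_integral_interp_le {w α : Z → ℝ} {β : Z → Vec d} (hw : MemLp w 2 ν) (hα : MemLp α 2 ν)
    (hβ : MemLp β 2 ν) (a : ℝ) (b : Vec d) {r : ℝ} (h0 : 0 ≤ r) (h1 : r ≤ 1)
    (hint : Integrable
      (fun z => (w z : ℂ) * (interp r (a + α z) (b + β z) - interp r a b)) ν) :
    ‖Complex.I * (∫ z, (w z : ℂ) * (interp r (a + α z) (b + β z) - interp r a b) ∂ν) +
        (r * ‖b‖ ^ 2 : ℝ) * interp r a b‖ₑ ≤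
      ‖∫ z, w z * α z ∂ν - ‖b‖ ^ 2‖ₑ + ‖∫ z, w z * inner ℝ b (β z) ∂ν‖ₑ +
        3 * ∫⁻ z, ‖w z‖ₑ * (‖α z‖ₑ ^ 2 + ‖β z‖ₑ ^ 2) ∂ν := by
  have hr2 : r ^ 2 ≤ 1 := by nlinarith
  set G := interp r a b with hG
  have hG1 : ‖G‖ ≤ 1 := norm_interp_le hr2 a b
  have hi1 : Integrable (fun z => w z * α z) ν := hw.integrable_mul hα
  have hi2 : Integrable (fun z => w z * inner ℝ b (β z)) ν := hw.integrable_mul (hβ.const_inner b)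
  have hi12 : Integrable (fun z => ((w z * α z : ℝ) : ℂ) * (G * r * Complex.I) -
      ((w z * inner ℝ b (β z) : ℝ) : ℂ) * (G * (1 - r ^ 2 : ℝ))) ν :=
    (hi1.ofReal.mul_const _).sub (hi2.ofReal.mul_const _)
  set T := fun z => (w z : ℂ) * (interp r (a + α z) (b + β z) - G - G *
      ((r * α z : ℝ) * Complex.I - ((1 - r ^ 2) * inner ℝ b (β z) : ℝ))) with hT
  have hsplit : ∀ z, (w z : ℂ) * (interp r (a + α z) (b + β z) - G) = T z +
      (((w z * α z : ℝ) : ℂ) * (G * r * Complex.I) -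
      ((w z * inner ℝ b (β z) : ℝ) : ℂ) * (G * (1 - r ^ 2 : ℝ))) := fun z => by
    simp only [hT]; push_cast; ring
  -- The remainder is integrable as a difference of integrable functions; the integral of its
  -- quadratic bound may be infinite.
  have hTi : Integrable T ν := by
    refine (hint.sub hi12).congr (ae_of_all _ fun z => ?_)
    simp only [Pi.sub_apply, hsplit, add_sub_cancel_right]
  have e1 : ∫ z, (w z : ℂ) * (interp r (a + α z) (b + β z) - G) ∂ν = (∫ z, T z ∂ν) +
      ((∫ z, w z * α z ∂ν : ℝ) * (G * r * Complex.I) -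
        (∫ z, w z * inner ℝ b (β z) ∂ν : ℝ) * (G * (1 - r ^ 2 : ℝ))) := by
    simp only [hsplit]
    rw [integral_add hTi hi12, integral_sub (hi1.ofReal.mul_const _) (hi2.ofReal.mul_const _),
      integral_mul_const, integral_mul_const, integral_complex_ofReal, integral_complex_ofReal]
  -- Since i² = -1, the first-order term in α is -rG ∫ wα. It meets r|b|²G, and only the defect ∫ wα
  -- - |b|² survives.
  have e2 : Complex.I * ((∫ z, T z ∂ν) +
      ((∫ z, w z * α z ∂ν : ℝ) * (G * r * Complex.I) -
        (∫ z, w z * inner ℝ b (β z) ∂ν : ℝ) * (G * (1 - r ^ 2 : ℝ)))) + (r * ‖b‖ ^ 2 : ℝ) * G =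
      ((∫ z, w z * α z ∂ν - ‖b‖ ^ 2 : ℝ) : ℂ) * (-(G * r)) +
        (∫ z, w z * inner ℝ b (β z) ∂ν : ℝ) * (-(Complex.I * (G * (1 - r ^ 2 : ℝ)))) +
        Complex.I * (∫ z, T z ∂ν) := by
    push_cast
    linear_combination (∫ z, w z * α z ∂ν : ℝ) * G * r * Complex.I_sq
  rw [e1, e2]
  have hle : ∀ (x : ℝ) (y : ℂ), ‖y‖ ≤ 1 → ‖(x : ℂ) * y‖ₑ ≤ ‖x‖ₑ := fun x y hy => by
    rw [enorm_le_iff_norm_le, norm_mul, Complex.norm_real]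
    exact mul_le_of_le_one_right (norm_nonneg _) hy
  refine (enorm_add_le _ _).trans (add_le_add ((enorm_add_le _ _).trans (add_le_add ?_ ?_)) ?_)
  · refine hle _ _ ?_
    rw [norm_neg, norm_mul, Complex.norm_real, Real.norm_of_nonneg h0]
    exact mul_le_one₀ hG1 h0 h1
  · refine hle _ _ ?_
    rw [norm_neg, norm_mul, Complex.norm_I, one_mul, norm_mul, Complex.norm_real,
      Real.norm_of_nonneg (by linarith)]
    exact mul_le_one₀ hG1 (by linarith) (by nlinarith)
  · rw [enorm_mul]
    have : ‖Complex.I‖ₑ = 1 := by rw [← ofReal_norm]; simp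
    rw [this, one_mul, ← lintegral_const_mul' _ _ (by norm_num)]
    refine (enorm_integral_le_lintegral_enorm _).trans (lintegral_mono fun z => ?_)
    simp only [hT]
    rw [enorm_mul, mul_left_comm]
    gcongr
    · rw [enorm_le_iff_norm_le, Complex.norm_real]
    · have := norm_interp_taylor_le h0 h1 a (α z) b (β z)
      rw [← ofReal_norm]
      refine (ENNReal.ofReal_le_ofReal this).trans (le_of_eq ?_)
      rw [ENNReal.ofReal_mul (by norm_num), ENNReal.ofReal_add (by positivity) (by positivity),
        ← sq_abs, ENNReal.ofReal_pow (abs_nonneg _), ENNReal.ofReal_pow (norm_nonneg _),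
        ← Real.norm_eq_abs, ofReal_norm, ofReal_norm]
      simp

end Interpolation

section Interpolation

variable {Ω Z : Type*} [MeasurableSpace Ω] [MeasurableSpace Z] {P : Measure Ω}
  {ν : Measure Z} {η : Ω → Measure Z} {d : ℕ}

/-- Interpolation bound: the distance between the characteristic function of `A = δ w` and that of
the Gaussian mixture with conditional variance `|b|²`. -/
theorem enorm_integral_interp_sub_le [SigmaFinite ν] [IsProbabilityMeasure P]
    (hη : IsPoissonProcess η ν P) {w : Measure Z → Z → ℝ} {A : Measure Z → ℝ}
    {b : Measure Z → Vec d} (hw : IsDelta η ν P w A) (hA : MemDomD η ν P A) (hb : Measurable b)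
    (hb2 : MemLp (fun ω => b (η ω)) 2 P)
    (hbD : ∫⁻ ω, ∫⁻ z, ‖addOp b (η ω) z‖ₑ ^ 2 ∂ν ∂P < ∞) :
    ‖∫ ω, interp 1 (A (η ω)) (b (η ω)) ∂P - ∫ ω, interp 0 (A (η ω)) (b (η ω)) ∂P‖ₑ ≤
      ∫⁻ ω, ‖∫ z, w (η ω) z * addOp A (η ω) z ∂ν - ‖b (η ω)‖ ^ 2‖ₑ ∂P +
      ∫⁻ ω, ‖∫ z, w (η ω) z * inner ℝ (b (η ω)) (addOp b (η ω) z) ∂ν‖ₑ ∂P +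
      3 * ∫⁻ ω, ∫⁻ z, ‖w (η ω) z‖ₑ * (‖addOp A (η ω) z‖ₑ ^ 2 + ‖addOp b (η ω) z‖ₑ ^ 2) ∂ν ∂P := by
  have hwm := hw.measurable_comp hη
  have hαm := hη.measurable_addOp hA.measurable
  have hβm := hη.measurable_addOp hb
  have hAm : Measurable fun ω => A (η ω) := hA.measurable.comp hη.measurable
  have hbm : Measurable fun ω => b (η ω) := hb.comp hη.measurable
  set R := ∫⁻ ω, ‖∫ z, w (η ω) z * addOp A (η ω) z ∂ν - ‖b (η ω)‖ ^ 2‖ₑ ∂P +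
      ∫⁻ ω, ‖∫ z, w (η ω) z * inner ℝ (b (η ω)) (addOp b (η ω) z) ∂ν‖ₑ ∂P +
      3 * ∫⁻ ω, ∫⁻ z, ‖w (η ω) z‖ₑ * (‖addOp A (η ω) z‖ₑ ^ 2 + ‖addOp b (η ω) z‖ₑ ^ 2) ∂ν ∂P
    with hR
  have hbound : ∀ r : ℝ, 0 ≤ r → r < 1 →
      ‖∫ ω, (A (η ω) * Complex.I + (r * ‖b (η ω)‖ ^ 2 : ℝ)) *
        interp r (A (η ω)) (b (η ω)) ∂P‖ₑ ≤ R := by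
    intro r h0 h1
    have hr2 : r ^ 2 ≤ 1 := by nlinarith
    have hGm : Measurable fun ξ => interp r (A ξ) (b ξ) :=
      (measurable_interp r).comp (hA.measurable.prodMk hb)
    have haddG : ∀ ω z, addOp (fun ξ => interp r (A ξ) (b ξ)) (η ω) z =
        interp r (A (η ω) + addOp A (η ω) z) (b (η ω) + addOp b (η ω) z) -
          interp r (A (η ω)) (b (η ω)) := fun ω z => by simp [addOp]
    -- `interp r` is Lipschitz, so the composition inherits square integrable add derivatives from
    -- `A` and `b`.
    have hGD : ∫⁻ ω, ∫⁻ z, ‖addOp (fun ξ => interp r (A ξ) (b ξ)) (η ω) z‖ₑ ^ 2 ∂ν ∂P < ∞ := by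
      have h2 : ∫⁻ ω, ∫⁻ z, ‖addOp (fun ξ => interp r (A ξ) (b ξ)) (η ω) z‖ₑ ^ 2 ∂ν ∂P ≤
          ∫⁻ ω, ∫⁻ z, 2 * (‖addOp A (η ω) z‖ₑ ^ 2 + ‖addOp b (η ω) z‖ₑ ^ 2) ∂ν ∂P := by
        refine lintegral_mono fun ω => lintegral_mono fun z => ?_
        have h3 := norm_interp_sub_le h0 h1.le (A (η ω)) (addOp A (η ω) z) (b (η ω))
          (addOp b (η ω) z)
        rw [← haddG] at h3
        have h4 : ‖addOp (fun ξ => interp r (A ξ) (b ξ)) (η ω) z‖ ^ 2 ≤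
            2 * (‖addOp A (η ω) z‖ ^ 2 + ‖addOp b (η ω) z‖ ^ 2) := by
          rw [← Real.norm_eq_abs] at h3
          refine (pow_le_pow_left₀ (norm_nonneg _) h3 2).trans ?_
          nlinarith [sq_nonneg (‖addOp A (η ω) z‖ - ‖addOp b (η ω) z‖)]
        simp only [← ofReal_norm, ← ENNReal.ofReal_pow (norm_nonneg _)]
        rw [← ENNReal.ofReal_add (by positivity) (by positivity)]
        refine (ENNReal.ofReal_le_ofReal h4).trans (le_of_eq ?_)
        rw [ENNReal.ofReal_mul (by norm_num)]
        simp
      refine h2.trans_lt ?_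
      have h5 : ∀ ω, ∫⁻ z, 2 * (‖addOp A (η ω) z‖ₑ ^ 2 + ‖addOp b (η ω) z‖ₑ ^ 2) ∂ν =
          2 * (∫⁻ z, ‖addOp A (η ω) z‖ₑ ^ 2 ∂ν + ∫⁻ z, ‖addOp b (η ω) z‖ₑ ^ 2 ∂ν) := fun ω => by
        have := hαm.comp (measurable_prodMk_left (x := ω))
        rw [lintegral_const_mul' _ _ (by norm_num), lintegral_add_left]
        exact this.enorm.pow_const 2
      simp only [h5]
      rw [lintegral_const_mul' _ _ (by norm_num), lintegral_add_left]
      · exact ENNReal.mul_lt_top (by norm_num) (ENNReal.add_lt_top.2 ⟨hA.deriv, hbD⟩)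
      · exact Measurable.lintegral_prod_right' (f := fun p : Ω × Z => ‖addOp A (η p.1) p.2‖ₑ ^ 2)
          (hαm.enorm.pow_const 2)
    obtain ⟨hint, hdual⟩ := hw.duality_complex hη hGm (fun ξ => norm_interp_le hr2 _ _) hGD
    rw [integral_prod _ hint] at hdual
    have hGi : Integrable (fun ω => ((r * ‖b (η ω)‖ ^ 2 : ℝ) : ℂ) *
        interp r (A (η ω)) (b (η ω))) P :=
      ((hb2.integrable_norm_pow' (p := 2)).const_mul r).ofReal.mul_bdd (c := 1)
        (hGm.comp hη.measurable).aestronglyMeasurable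
        (ae_of_all _ fun ω => norm_interp_le hr2 _ _)
    have hAi : Integrable (fun ω => (A (η ω) : ℂ) * interp r (A (η ω)) (b (η ω))) P :=
      (hA.memLp.integrable (by norm_num)).ofReal.mul_bdd (c := 1)
        (hGm.comp hη.measurable).aestronglyMeasurable
        (ae_of_all _ fun ω => norm_interp_le hr2 _ _)
    -- Only the summand containing A is transformed by duality; r|b|² stays, to be cancelled inside
    -- the expectation by the pointwise expansion.
    have e1 : ∫ ω, (A (η ω) * Complex.I + (r * ‖b (η ω)‖ ^ 2 : ℝ)) *
        interp r (A (η ω)) (b (η ω)) ∂P =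
        ∫ ω, (Complex.I * (∫ z, (w (η ω) z : ℂ) *
          (interp r (A (η ω) + addOp A (η ω) z) (b (η ω) + addOp b (η ω) z) -
          interp r (A (η ω)) (b (η ω))) ∂ν) +
          (r * ‖b (η ω)‖ ^ 2 : ℝ) * interp r (A (η ω)) (b (η ω))) ∂P := by
      simp only [haddG] at hdual hint
      rw [integral_add (hint.integral_prod_left.const_mul _) hGi, integral_const_mul, ← hdual,
        ← integral_const_mul, ← integral_add (hAi.const_mul _) hGi]
      exact integral_congr_ae (ae_of_all _ fun ω => by ring)
    rw [e1]
    refine (enorm_integral_le_lintegral_enorm _).trans ?_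
    have hm1 : Measurable fun ω => ‖∫ z, w (η ω) z * addOp A (η ω) z ∂ν - ‖b (η ω)‖ ^ 2‖ₑ := by
      have : StronglyMeasurable fun ω => ∫ z, w (η ω) z * addOp A (η ω) z ∂ν :=
        StronglyMeasurable.integral_prod_right'
          (f := fun p : Ω × Z => w (η p.1) p.2 * addOp A (η p.1) p.2)
          (hwm.mul hαm).stronglyMeasurable
      exact (this.measurable.sub (hbm.norm.pow_const 2)).enorm
    have hm2 : Measurable fun ω =>
        ‖∫ z, w (η ω) z * inner ℝ (b (η ω)) (addOp b (η ω) z) ∂ν‖ₑ := by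
      have : StronglyMeasurable fun ω =>
          ∫ z, w (η ω) z * inner ℝ (b (η ω)) (addOp b (η ω) z) ∂ν :=
        StronglyMeasurable.integral_prod_right'
          (f := fun p : Ω × Z => w (η p.1) p.2 * inner ℝ (b (η p.1)) (addOp b (η p.1) p.2))
          (hwm.mul ((hbm.comp measurable_fst).inner hβm)).stronglyMeasurable
      exact this.measurable.enorm
    rw [hR, ← lintegral_const_mul' _ _ (by norm_num), ← lintegral_add_left hm1,
      ← lintegral_add_left (hm1.fun_add hm2)]
    refine lintegral_mono_ae ?_
    have hwL : ∫⁻ ω, ∫⁻ z, ‖w (η ω) z‖ₑ ^ 2 ∂ν ∂P < ∞ := by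
      have := lintegral_lt_top_of_memLp_two hw.dom.memLp
      rwa [lintegral_prod _ (hwm.enorm.pow_const 2).aemeasurable] at this
    filter_upwards [ae_memLp_two_slice hwm hwL, ae_memLp_two_slice hαm hA.deriv,
      ae_memLp_two_slice hβm hbD, hint.prod_right_ae] with ω h2 h3 h4 h5
    simp only [haddG] at h5
    exact enorm_integral_interp_le h2 h3 h4 _ _ h0 h1.le h5
  rcases eq_or_ne R ∞ with hRtop | hRtop
  · rw [hRtop]; exact le_top
  have := norm_image_sub_le_of_norm_deriv_right_le_segment
    (f := fun r : ℝ => ∫ ω, interp r (A (η ω)) (b (η ω)) ∂P) (a := 0) (b := 1) (C := R.toReal)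
    (continuousOn_integral_interp hAm hbm)
    (fun r hr => (hasDerivAt_integral_interp hAm hbm hA.memLp hb2 hr.1 hr.2).hasDerivWithinAt)
    (fun r hr => by
      have := ENNReal.toReal_mono hRtop (hbound r hr.1 hr.2)
      rwa [toReal_enorm] at this) 1 (by simp)
  rw [← ofReal_norm]
  refine ENNReal.ofReal_le_of_le_toReal ?_
  simpa using this

end Interpolation

/-! ### Linear combinations of coordinates. -/

section Linear

variable {Ω Z : Type*} [MeasurableSpace Ω] [MeasurableSpace Z] {P : Measure Ω}
  {ν : Measure Z} {η : Ω → Measure Z}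

lemma MemDomD.memLp_addOp [SigmaFinite ν] {f : Measure Z → ℝ} (hf : MemDomD η ν P f)
    (hη : IsPoissonProcess η ν P) :
    MemLp (fun p : Ω × Z => addOp f (η p.1) p.2) 2 (P.prod ν) := by
  have hm := hη.measurable_addOp hf.measurable
  refine memLp_two_of_lintegral_lt_top hm.aestronglyMeasurable ?_
  rw [lintegral_prod _ (hm.enorm.pow_const 2).aemeasurable]
  exact hf.deriv

lemma memDomD_of_memLp [SigmaFinite ν] {f : Measure Z → ℝ} (hη : IsPoissonProcess η ν P)
    (hf : Measurable f) (hf2 : MemLp (fun ω => f (η ω)) 2 P)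
    (hD : MemLp (fun p : Ω × Z => addOp f (η p.1) p.2) 2 (P.prod ν)) : MemDomD η ν P f := by
  refine ⟨hf, hf2, ?_⟩
  have := lintegral_lt_top_of_memLp_two hD
  rwa [lintegral_prod _ ((hη.measurable_addOp hf).enorm.pow_const 2).aemeasurable] at this

lemma memDomD_sum [SigmaFinite ν] {ι : Type*} [Fintype ι] (c : ι → ℝ) {f : ι → Measure Z → ℝ}
    (hη : IsPoissonProcess η ν P) (hf : ∀ i, MemDomD η ν P (f i)) :
    MemDomD η ν P (fun ξ => ∑ i, c i * f i ξ) := by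
  refine memDomD_of_memLp hη (Finset.measurable_sum _ fun i _ => (hf i).measurable.const_mul _)
    (memLp_finsetSum _ fun i _ => (hf i).memLp.const_mul _) ?_
  have : (fun p : Ω × Z => addOp (fun ξ => ∑ i, c i * f i ξ) (η p.1) p.2) =
      fun p => ∑ i, c i * addOp (f i) (η p.1) p.2 := by
    ext p
    simp [addOp, mul_sub]
  rw [this]
  exact memLp_finsetSum _ fun i _ => ((hf i).memLp_addOp hη).const_mul _

/-- With c = l this reduces the vector problem to a scalar one: ⟨l, F⟩ is the divergence of ⟨l, u⟩.
-/
lemma isDelta_sum [SigmaFinite ν] [IsProbabilityMeasure P] {ι : Type*} [Fintype ι] (c : ι → ℝ)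
    {u : ι → Measure Z → Z → ℝ} {f : ι → Measure Z → ℝ}
    (hη : IsPoissonProcess η ν P) (hu : ∀ i, IsDelta η ν P (u i) (f i)) :
    IsDelta η ν P (fun ξ z => ∑ i, c i * u i ξ z) (fun ξ => ∑ i, c i * f i ξ) := by
  have hint : ∀ G, MemDomD η ν P G → ∀ i,
      Integrable (fun p : Ω × Z => u i (η p.1) p.2 * addOp G (η p.1) p.2) (P.prod ν) :=
    fun G hG i => (hu i).dom.memLp.integrable_mul (hG.memLp_addOp hη)
  have hsum : ∀ G, MemDomD η ν P G →
      ∫ ω, ∫ z, (∑ i, c i * u i (η ω) z) * addOp G (η ω) z ∂ν ∂P =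
        ∑ i, c i * ∫ ω, ∫ z, u i (η ω) z * addOp G (η ω) z ∂ν ∂P := by
    intro G hG
    have e : ∀ p : Ω × Z, (∑ i, c i * u i (η p.1) p.2) * addOp G (η p.1) p.2 =
        ∑ i, c i * (u i (η p.1) p.2 * addOp G (η p.1) p.2) := fun p => by
      rw [Finset.sum_mul]; exact Finset.sum_congr rfl fun i _ => by ring
    have hi : Integrable (fun p : Ω × Z =>
        (∑ i, c i * u i (η p.1) p.2) * addOp G (η p.1) p.2) (P.prod ν) := by
      simp only [e]
      exact integrable_finsetSum _ fun i _ => (hint G hG i).const_mul _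
    rw [← integral_prod _ hi]
    simp only [e]
    rw [integral_finsetSum _ fun i _ => (hint G hG i).const_mul _]
    refine Finset.sum_congr rfl fun i _ => ?_
    rw [integral_const_mul, integral_prod _ (hint G hG i)]
  refine ⟨⟨?_, memLp_finsetSum _ fun i _ => (hu i).dom.memLp.const_mul _, ?_⟩,
    Finset.measurable_sum _ fun i _ => (hu i).measurable.const_mul _,
    memLp_finsetSum _ fun i _ => (hu i).memLp.const_mul _, ?_⟩
  · exact Finset.measurable_sum _ fun i _ => (hu i).dom.measurable.const_mul _
  · choose C hC using fun i => (hu i).dom.bound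
    refine ⟨∑ i, |c i| * C i, fun G hG => ?_⟩
    have := hsum G hG
    simp only [mul_comm _ (addOp G _ _)] at this
    rw [this, Finset.sum_mul]
    refine (Finset.abs_sum_le_sum_abs _ _).trans (Finset.sum_le_sum fun i _ => ?_)
    rw [abs_mul, mul_assoc]
    exact mul_le_mul_of_nonneg_left (hC i G hG) (abs_nonneg _)
  · intro G hG
    rw [hsum G hG]
    simp only [Finset.mul_sum]
    rw [integral_finsetSum]
    · refine Finset.sum_congr rfl fun i _ => ?_
      rw [← (hu i).duality G hG, ← integral_const_mul]
      exact integral_congr_ae (ae_of_all _ fun ω => by ring)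
    · intro i _
      exact hG.memLp.integrable_mul ((hu i).memLp.const_mul (c i))

end Linear

/-! ### Scalar contractions of brackets and matrices. -/

section Norms

lemma abs_le_ellTwo {ι : Type*} [Fintype ι] (x : ι → ℝ) (i : ι) : |x i| ≤ ellTwo x :=
  Real.abs_le_sqrt (Finset.single_le_sum (f := fun i => x i ^ 2) (fun _ _ => sq_nonneg _)
    (Finset.mem_univ i))

lemma abs_sum_mul_le_ellTwo {ι : Type*} [Fintype ι] (c x : ι → ℝ) :
    |∑ i, c i * x i| ≤ (∑ i, |c i|) * ellTwo x := by
  rw [Finset.sum_mul]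
  refine (Finset.abs_sum_le_sum_abs _ _).trans (Finset.sum_le_sum fun i _ => ?_)
  rw [abs_mul]
  exact mul_le_mul_of_nonneg_left (abs_le_ellTwo x i) (abs_nonneg _)

/-- The vector `Aᵀ l`. -/
noncomputable def tmul {d : ℕ} (A : Mat d) (l : Vec d) : Vec d :=
  WithLp.toLp 2 (A.transpose.mulVec l.ofLp)

lemma tmul_apply {d : ℕ} (A : Mat d) (l : Vec d) (j : Fin d) :
    tmul A l j = ∑ i, l i * A i j := by
  simp [tmul, Matrix.mulVec, dotProduct, mul_comm]

lemma norm_tmul_le {d : ℕ} (A : Mat d) (l : Vec d) : ‖tmul A l‖ ≤ ‖l‖ * matNorm A := by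
  have h0 : 0 ≤ ‖l‖ * matNorm A := mul_nonneg (norm_nonneg _) (Real.sqrt_nonneg _)
  rw [← abs_of_nonneg (norm_nonneg (tmul A l)), ← abs_of_nonneg h0]
  refine sq_le_sq.1 ?_
  rw [mul_pow, matNorm, ellTwo, Real.sq_sqrt (Finset.sum_nonneg fun _ _ => sq_nonneg _),
    EuclideanSpace.norm_sq_eq, EuclideanSpace.norm_sq_eq, Fintype.sum_prod_type,
    Finset.sum_comm, Finset.mul_sum]
  refine Finset.sum_le_sum fun j _ => ?_
  simp only [Real.norm_eq_abs, sq_abs, tmul_apply]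
  exact Finset.sum_mul_sq_le_sq_mul_sq _ _ _

lemma inner_tmul {d : ℕ} (A B : Mat d) (l : Vec d) :
    inner ℝ (tmul A l) (tmul B l) =
      ∑ p : Fin d × Fin d, (l p.1 * l p.2) * (B * A.transpose) p.1 p.2 := by
  have h1 : inner ℝ (tmul A l) (tmul B l) =
      ∑ j, ∑ k, ∑ i, (l k * B k j) * (l i * A i j) := by
    rw [PiLp.inner_apply]
    refine Finset.sum_congr rfl fun j _ => ?_
    rw [← Finset.sum_mul_sum, ← tmul_apply, ← tmul_apply]
    simp
  rw [h1, Fintype.sum_prod_type, Finset.sum_comm]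
  refine Finset.sum_congr rfl fun k _ => ?_
  rw [Finset.sum_comm]
  refine Finset.sum_congr rfl fun i _ => ?_
  simp only [Matrix.mul_apply, Matrix.transpose_apply, Finset.mul_sum]
  exact Finset.sum_congr rfl fun j _ => by ring

lemma norm_tmul_sq {d : ℕ} (A : Mat d) (l : Vec d) :
    ‖tmul A l‖ ^ 2 = ∑ p : Fin d × Fin d, (l p.1 * l p.2) * (A * A.transpose) p.1 p.2 := by
  rw [← real_inner_self_eq_norm_sq, inner_tmul]

/-- A quadratic form sees only the symmetric part of its matrix, so a decomposition of the
symmetrized bracket is enough. -/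
lemma sum_symmetrize {d : ℕ} (M : Mat d) (l : Vec d) :
    ∑ p : Fin d × Fin d, (l p.1 * l p.2) * symmetrize M p.1 p.2 =
      ∑ p : Fin d × Fin d, (l p.1 * l p.2) * M p.1 p.2 := by
  have h : ∑ p : Fin d × Fin d, (l p.1 * l p.2) * M p.2 p.1 =
      ∑ p : Fin d × Fin d, (l p.1 * l p.2) * M p.1 p.2 :=
    Fintype.sum_equiv (Equiv.prodComm _ _) _ _ fun p => by simp [mul_comm]
  have : ∀ p : Fin d × Fin d, (l p.1 * l p.2) * symmetrize M p.1 p.2 =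
      1 / 2 * ((l p.1 * l p.2) * M p.1 p.2) + 1 / 2 * ((l p.1 * l p.2) * M p.2 p.1) := fun p => by
    simp [symmetrize]; ring
  simp only [this, Finset.sum_add_distrib, ← Finset.mul_sum, h]
  ring

variable {Z : Type*} [MeasurableSpace Z] {ν : Measure Z} {d : ℕ}

lemma integral_mul_eq_bracket {u v : Z → Vec d} (hu : ∀ i, MemLp (fun z => u z i) 2 ν)
    (hv : ∀ i, MemLp (fun z => v z i) 2 ν) (l : Vec d) :
    ∫ z, (∑ i, l i * u z i) * (∑ i, l i * v z i) ∂ν =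
      ∑ p : Fin d × Fin d, (l p.1 * l p.2) * bracket ν u v p.1 p.2 := by
  have : ∀ z, (∑ i, l i * u z i) * (∑ i, l i * v z i) =
      ∑ p : Fin d × Fin d, (l p.1 * l p.2) * (u z p.1 * v z p.2) := fun z => by
    rw [Finset.sum_mul_sum, Fintype.sum_prod_type]
    exact Finset.sum_congr rfl fun i _ => Finset.sum_congr rfl fun j _ => by ring
  simp only [this]
  rw [integral_finsetSum _ fun p _ => ((hu p.1).integrable_mul (hv p.2)).const_mul _]
  exact Finset.sum_congr rfl fun p _ => by rw [integral_const_mul]; rfl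

/-- With A = S and B = DS, the first-order term in DS becomes a contraction of the tensor in (RS).
-/
lemma integral_mul_inner_eq_bracketMat {u : Z → Vec d} {B : Z → Mat d}
    (hu : ∀ i, MemLp (fun z => u z i) 2 ν)
    (hB : ∀ i j, MemLp (fun z => B z i j) 2 ν) (A : Mat d) (l : Vec d) :
    ∫ z, (∑ i, l i * u z i) * inner ℝ (tmul A l) (tmul (B z) l) ∂ν =
      ∑ p : Fin d × Fin d × Fin d, (l p.1 * (l p.2.1 * l p.2.2)) *
        bracketMat ν u (fun z => B z * A.transpose) p := by
  have : ∀ z, (∑ i, l i * u z i) * inner ℝ (tmul A l) (tmul (B z) l) =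
      ∑ p : Fin d × Fin d × Fin d, (l p.1 * (l p.2.1 * l p.2.2)) *
        (u z p.1 * (B z * A.transpose) p.2.1 p.2.2) := fun z => by
    rw [inner_tmul, Finset.sum_mul_sum, Fintype.sum_prod_type]
    exact Finset.sum_congr rfl fun i _ => Finset.sum_congr rfl fun j _ => by ring
  simp only [this]
  have hBA : ∀ i j, MemLp (fun z => (B z * A.transpose) i j) 2 ν := fun i j => by
    simp only [Matrix.mul_apply, Matrix.transpose_apply]
    exact memLp_finsetSum _ fun k _ => (hB i k).mul_const _
  rw [integral_finsetSum _ fun p _ => ((hu p.1).integrable_mul (hBA p.2.1 p.2.2)).const_mul _]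
  exact Finset.sum_congr rfl fun p _ => by rw [integral_const_mul]; rfl

end Norms

/-! ### Passages to the limit. -/

section Limits

variable {Ω Z : Type*} [MeasurableSpace Ω] [MeasurableSpace Z] {P : Measure Ω}
  {ν : Measure Z}

/-- On a set of finite measure, `L²` convergence to zero implies `L¹` convergence. -/
lemma tendsto_lintegral_of_sq [SigmaFinite ν] [IsProbabilityMeasure P] {X : ℕ → Ω × Z → ℝ≥0∞}
    (hX : ∀ n, Measurable (X n)) {B : Set Z} (hνB : ν B < ∞)
    (h : Tendsto (fun n => ∫⁻ ω, ∫⁻ z in B, X n (ω, z) ^ 2 ∂ν ∂P) atTop (𝓝 0)) :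
    Tendsto (fun n => ∫⁻ ω, ∫⁻ z in B, X n (ω, z) ∂ν ∂P) atTop (𝓝 0) := by
  have hle : ∀ n, ∫⁻ ω, ∫⁻ z in B, X n (ω, z) ∂ν ∂P ≤
      (∫⁻ ω, ∫⁻ z in B, X n (ω, z) ^ 2 ∂ν ∂P) ^ (1 / 2 : ℝ) * (ν B) ^ (1 / 2 : ℝ) := by
    intro n
    -- Cauchy–Schwarz against 1 on the product with ν restricted to `B`, whose total mass is ν(B).
    have h1 := ENNReal.lintegral_mul_le_Lp_mul_Lq (P.prod (ν.restrict B))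
      Real.HolderConjugate.two_two (hX n).aemeasurable (g := fun _ => 1) aemeasurable_const
    simp only [Pi.mul_apply, mul_one, ENNReal.one_rpow, lintegral_const, one_mul] at h1
    rw [lintegral_prod _ (hX n).aemeasurable,
      lintegral_prod _ ((hX n).pow_const _).aemeasurable] at h1
    simpa [Measure.prod_apply, ← Set.univ_prod_univ] using h1
  refine tendsto_of_tendsto_of_tendsto_of_le_of_le tendsto_const_nhds ?_ (fun _ => zero_le) hle
  have h2 := ENNReal.Tendsto.mul_const (b := (ν B) ^ (1 / 2 : ℝ)) (h.ennrpow_const (1 / 2 : ℝ))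
    (Or.inr (ENNReal.rpow_ne_top_of_nonneg (by norm_num) hνB.ne))
  simpa using h2

end Limits

/-- Lévy's continuity theorem for pairs. -/
lemma tendstoInDistribution_prodMk_of_charFun {Ω Ω' : Type*} [MeasurableSpace Ω]
    [MeasurableSpace Ω'] {P : Measure Ω} [IsProbabilityMeasure P] {P' : Measure Ω'}
    [IsProbabilityMeasure P'] {d : ℕ} {X : ℕ → Ω → Vec d} {Y : Ω → ℝ} {X' : Ω' → Vec d}
    {Y' : Ω' → ℝ} (hX : ∀ n, AEMeasurable (X n) P) (hY : AEMeasurable Y P)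
    (hX' : AEMeasurable X' P') (hY' : AEMeasurable Y' P')
    (h : ∀ (l : Vec d) (t : ℝ), Tendsto
      (fun n => ∫ ω, Complex.exp (((inner ℝ (X n ω) l + t * Y ω : ℝ) : ℂ) * Complex.I) ∂P) atTop
      (𝓝 (∫ ω, Complex.exp (((inner ℝ (X' ω) l + t * Y' ω : ℝ) : ℂ) * Complex.I) ∂P'))) :
    TendstoInDistribution (fun n ω => (X n ω, Y ω)) atTop (fun ω => (X' ω, Y' ω))
      (fun _ => P) P' := by
  -- The plain product carries the sup norm and no inner product. Characteristic functions are taken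
  -- in its ℓ² version, and the result returns along a continuous map.
  have hm := WithLp.measurable_toLp 2 (Vec d × ℝ)
  have h1 : ∀ n, AEMeasurable (fun ω => WithLp.toLp 2 (X n ω, Y ω)) P :=
    fun n => hm.comp_aemeasurable ((hX n).prodMk hY)
  have h2 : AEMeasurable (fun ω => WithLp.toLp 2 (X' ω, Y' ω)) P' :=
    hm.comp_aemeasurable (hX'.prodMk hY')
  have key : TendstoInDistribution (fun n ω => WithLp.toLp 2 (X n ω, Y ω)) atTop
      (fun ω => WithLp.toLp 2 (X' ω, Y' ω)) (fun _ => P) P' := by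
    refine ⟨h1, h2, ProbabilityMeasure.tendsto_iff_tendsto_charFun.2 fun v => ?_⟩
    have e1 : ∀ n, charFun (P.map fun ω => WithLp.toLp 2 (X n ω, Y ω)) v =
        ∫ ω, Complex.exp (((inner ℝ (X n ω) v.ofLp.1 + v.ofLp.2 * Y ω : ℝ) : ℂ) * Complex.I) ∂P :=
      fun n => by
        rw [charFun_apply, integral_map (h1 n) (by fun_prop)]
        simp [WithLp.prod_inner_apply]
    have e2 : charFun (P'.map fun ω => WithLp.toLp 2 (X' ω, Y' ω)) v =
        ∫ ω, Complex.exp (((inner ℝ (X' ω) v.ofLp.1 + v.ofLp.2 * Y' ω : ℝ) : ℂ) * Complex.I) ∂P' := by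
      rw [charFun_apply, integral_map h2 (by fun_prop)]
      simp [WithLp.prod_inner_apply]
    simp only [ProbabilityMeasure.coe_mk, e1, e2]
    exact h _ _
  have hg : Continuous fun x : WithLp 2 (Vec d × ℝ) => x.ofLp := by fun_prop
  exact key.continuous_comp hg

/-! ### Vector-valued functionals: local smallness and the quantitative comparison. -/

section Functionals

variable {Ω Z : Type*} [MeasurableSpace Ω] [MeasurableSpace Z] {P : Measure Ω}
  {ν : Measure Z} {η : Ω → Measure Z} {d : ℕ}

lemma measurable_vec {X : Type*} [MeasurableSpace X] {f : X → Vec d}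
    (h : ∀ i, Measurable fun x => f x i) : Measurable f :=
  (WithLp.measurable_toLp 2 _).comp (measurable_pi_lambda (fun x => (f x).ofLp) h)

lemma measurable_matNorm {X : Type*} [MeasurableSpace X] {f : X → Mat d}
    (h : ∀ i j, Measurable fun x => f x i j) : Measurable fun x => matNorm (f x) := by
  unfold matNorm ellTwo
  exact (Finset.measurable_sum _ fun p _ => (h p.1 p.2).pow_const 2).sqrt

lemma measurable_tmul {X : Type*} [MeasurableSpace X] {f : X → Mat d}
    (h : ∀ i j, Measurable fun x => f x i j) (l : Vec d) : Measurable fun x => tmul (f x) l := by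
  refine measurable_vec fun j => ?_
  simp only [tmul_apply]
  exact Finset.measurable_sum _ fun i _ => (h i j).const_mul _

lemma addOp_tmul (s : Measure Z → Mat d) (l : Vec d) (ξ : Measure Z) (z : Z) :
    addOp (fun ξ => tmul (s ξ) l) ξ z = tmul (addOp s ξ z) l := by
  ext j
  simp [addOp, tmul_apply, mul_sub]

lemma addOp_sum_mul (f : Measure Z → Vec d) (l : Vec d) (ξ : Measure Z) (z : Z) :
    addOp (fun ξ => ∑ i, l i * f ξ i) ξ z = ∑ i, l i * addOp f ξ z i := by
  simp [addOp, mul_sub]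

lemma norm_sum_mul_le (l x : Vec d) : ‖∑ i, l i * x i‖ ≤ ‖l‖ * ‖x‖ := by
  have := norm_inner_le_norm (𝕜 := ℝ) l x
  rw [PiLp.inner_apply] at this
  simpa [mul_comm] using this

lemma enorm_sum_mul_le (l x : Vec d) : ‖∑ i, l i * x i‖ₑ ≤ ‖l‖ₑ * ‖x‖ₑ := by
  simp only [← ofReal_norm]
  rw [← ENNReal.ofReal_mul (norm_nonneg _)]
  exact ENNReal.ofReal_le_ofReal (norm_sum_mul_le l x)

lemma enorm_tmul_le (A : Mat d) (l : Vec d) : ‖tmul A l‖ₑ ≤ ‖l‖ₑ * ENNReal.ofReal (matNorm A) := by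
  simp only [← ofReal_norm]
  rw [← ENNReal.ofReal_mul (norm_nonneg _)]
  exact ENNReal.ofReal_le_ofReal (norm_tmul_le A l)

lemma memDomD_tmul [SigmaFinite ν] (hη : IsPoissonProcess η ν P) {s : Measure Z → Mat d}
    (hs : ∀ i j, MemDomD η ν P fun ξ => s ξ i j) (l : Vec d) :
    MemLp (fun ω => tmul (s (η ω)) l) 2 P ∧
      ∫⁻ ω, ∫⁻ z, ‖addOp (fun ξ => tmul (s ξ) l) (η ω) z‖ₑ ^ 2 ∂ν ∂P < ∞ := by
  have h := fun j => memDomD_sum (fun i => l i) hη (fun i => hs i j)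
  have hm : Measurable fun ξ => tmul (s ξ) l := measurable_tmul (fun i j => (hs i j).measurable) l
  constructor
  · refine MemLp.of_eval_piLp fun j => ?_
    simpa only [tmul_apply] using (h j).memLp
  · have h2 : MemLp (fun p : Ω × Z => addOp (fun ξ => tmul (s ξ) l) (η p.1) p.2) 2
        (P.prod ν) := by
      refine MemLp.of_eval_piLp fun j => ?_
      have := (h j).memLp_addOp hη
      simpa only [addOp, PiLp.sub_apply, tmul_apply] using this
    have := lintegral_lt_top_of_memLp_two h2
    rwa [lintegral_prod _ ((hη.measurable_addOp hm).enorm.pow_const 2).aemeasurable] at this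

/-- Weighted convergence to zero implies local convergence to zero. -/
lemma tendsto_lintegral_local {X : ℕ → Ω → Z → ℝ≥0∞} (hd : Nonempty (Fin d))
    (h : ∀ h : Z → Vec d, MemLp h 2 ν →
      Tendsto (fun n => ∫⁻ ω, ∫⁻ z, ‖h z‖ₑ * X n ω z ∂ν ∂P) atTop (𝓝 0))
    {B : Set Z} (hB : MeasurableSet B) (hνB : ν B < ∞) :
    Tendsto (fun n => ∫⁻ ω, ∫⁻ z in B, X n ω z ∂ν ∂P) atTop (𝓝 0) := by
  obtain ⟨i⟩ := hd
  -- The test function 1_B e_i has norm 1_B; a unit vector exists because the dimension is positive.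
  have := h (B.indicator fun _ => EuclideanSpace.single i (1 : ℝ))
    (memLp_indicator_const 2 hB _ (Or.inr hνB.ne))
  refine this.congr fun n => lintegral_congr fun ω => ?_
  rw [← lintegral_indicator hB]
  refine lintegral_congr fun z => ?_
  by_cases hz : z ∈ B
  · have : ‖EuclideanSpace.single i (1 : ℝ)‖ₑ = 1 := by rw [← ofReal_norm]; simp
    simp [hz, this]
  · simp [hz]

lemma lintegral_lintegral_le_mul_add [SFinite ν] {T X Y : Ω → Z → ℝ≥0∞} {c : ℝ≥0∞} (hc : c ≠ ∞)
    (hX : Measurable (Function.uncurry X)) (h : ∀ ω z, T ω z ≤ c * (X ω z + Y ω z)) :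
    ∫⁻ ω, ∫⁻ z, T ω z ∂ν ∂P ≤
      c * (∫⁻ ω, ∫⁻ z, X ω z ∂ν ∂P + ∫⁻ ω, ∫⁻ z, Y ω z ∂ν ∂P) := by
  have hX' : Measurable fun ω => ∫⁻ z, X ω z ∂ν := hX.lintegral_prod_right'
  rw [← lintegral_add_left hX', ← lintegral_const_mul' _ _ hc]
  refine lintegral_mono fun ω => ?_
  have hXω : Measurable (X ω) := hX.comp measurable_prodMk_left
  rw [← lintegral_add_left hXω, ← lintegral_const_mul' _ _ hc]
  exact lintegral_mono (h ω)

/-- The functionals `interp r (⟨l, f⟩) (sᵀ l)` are mixing as soon as the add derivatives of `f`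
and `s` vanish locally. -/
lemma tendsto_lintegral_addOp_interp [SigmaFinite ν] [IsProbabilityMeasure P]
    (hη : IsPoissonProcess η ν P) {f : ℕ → Measure Z → Vec d} {s : ℕ → Measure Z → Mat d}
    (hf : ∀ n i, Measurable fun ξ => f n ξ i) (hs : ∀ n i j, Measurable fun ξ => s n ξ i j)
    (hRh : ∀ h : Z → Vec d, MemLp h 2 ν → Tendsto
      (fun n => ∫⁻ ω, ∫⁻ z, ‖h z‖ₑ * ‖addOp (f n) (η ω) z‖ₑ ^ 2 ∂ν ∂P) atTop (𝓝 0))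
    (hSh : ∀ h : Z → Vec d, MemLp h 2 ν → Tendsto
      (fun n => ∫⁻ ω, ∫⁻ z, ‖h z‖ₑ *
        ENNReal.ofReal (matNorm (addOp (s n) (η ω) z)) ^ 2 ∂ν ∂P) atTop (𝓝 0))
    (l : Vec d) {r : ℝ} (h0 : 0 ≤ r) (h1 : r ≤ 1) {B : Set Z} (hB : MeasurableSet B)
    (hνB : ν B < ∞) :
    Tendsto (fun n => ∫⁻ ω, ∫⁻ z in B, ‖addOp
      (fun ξ => interp r (∑ i, l i * f n ξ i) (tmul (s n ξ) l)) (η ω) z‖ₑ ∂ν ∂P) atTop (𝓝 0) := by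
  have hmf : ∀ n, Measurable fun p : Ω × Z => ‖addOp (f n) (η p.1) p.2‖ₑ := fun n =>
    (hη.measurable_addOp (measurable_vec (hf n))).enorm
  have hms : ∀ n, Measurable fun p : Ω × Z =>
      ENNReal.ofReal (matNorm (addOp (s n) (η p.1) p.2)) := fun n =>
    (measurable_matNorm fun i j => hη.measurable_addOp (hs n i j)).ennreal_ofReal
  have hF : Tendsto (fun n => ∫⁻ ω, ∫⁻ z in B, ‖addOp (f n) (η ω) z‖ₑ ∂ν ∂P) atTop (𝓝 0) := by
    -- In dimension 0 there is no unit vector to test with, but every derivative is zero.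
    rcases isEmpty_or_nonempty (Fin d) with hd | hd
    · have : ∀ n ω z, addOp (f n) (η ω) z = 0 := fun n ω z => by ext i; exact hd.elim i
      simp [this]
    · exact tendsto_lintegral_of_sq hmf hνB (tendsto_lintegral_local hd hRh hB hνB)
  have hS : Tendsto (fun n => ∫⁻ ω, ∫⁻ z in B,
      ENNReal.ofReal (matNorm (addOp (s n) (η ω) z)) ∂ν ∂P) atTop (𝓝 0) := by
    rcases isEmpty_or_nonempty (Fin d) with hd | hd
    · simp [matNorm, ellTwo]
    · exact tendsto_lintegral_of_sq hms hνB (tendsto_lintegral_local hd hSh hB hνB)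
  have hle : ∀ n, ∫⁻ ω, ∫⁻ z in B, ‖addOp
      (fun ξ => interp r (∑ i, l i * f n ξ i) (tmul (s n ξ) l)) (η ω) z‖ₑ ∂ν ∂P ≤
      ‖l‖ₑ * (∫⁻ ω, ∫⁻ z in B, ‖addOp (f n) (η ω) z‖ₑ ∂ν ∂P + ∫⁻ ω, ∫⁻ z in B,
      ENNReal.ofReal (matNorm (addOp (s n) (η ω) z)) ∂ν ∂P) := by
    intro n
    refine lintegral_lintegral_le_mul_add enorm_ne_top (hmf n) fun ω z => ?_
    have h3 := norm_interp_sub_le h0 h1 (∑ i, l i * f n (η ω) i)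
      (addOp (fun ξ => ∑ i, l i * f n ξ i) (η ω) z) (tmul (s n (η ω)) l)
      (addOp (fun ξ => tmul (s n ξ) l) (η ω) z)
    have h4 : ‖addOp (fun ξ => interp r (∑ i, l i * f n ξ i) (tmul (s n ξ) l)) (η ω) z‖ₑ ≤
        ‖addOp (fun ξ => ∑ i, l i * f n ξ i) (η ω) z‖ₑ +
          ‖addOp (fun ξ => tmul (s n ξ) l) (η ω) z‖ₑ := by
      simp only [← ofReal_norm]
      rw [← ENNReal.ofReal_add (norm_nonneg _) (norm_nonneg _)]
      refine ENNReal.ofReal_le_ofReal (le_trans (le_of_eq ?_) h3)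
      simp [addOp]
    refine h4.trans ?_
    rw [addOp_sum_mul, addOp_tmul, mul_add]
    exact add_le_add (enorm_sum_mul_le _ _) (enorm_tmul_le _ _)
  have hlim := ENNReal.Tendsto.const_mul (hF.add hS) (Or.inr (enorm_ne_top (x := l)))
  rw [add_zero, mul_zero] at hlim
  exact tendsto_of_tendsto_of_tendsto_of_le_of_le tendsto_const_nhds hlim (fun _ => zero_le) hle

/-- Quantitative comparison of the characteristic functions of a divergence and of the Gaussian
mixture. -/
lemma enorm_integral_interp_sub_le_of_decomposition [SigmaFinite ν] [IsProbabilityMeasure P]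
    (hη : IsPoissonProcess η ν P) {f : Measure Z → Vec d} {u : Measure Z → Z → Vec d}
    {s : Measure Z → Mat d} {ε : Ω → Mat d}
    (hf : ∀ i, MemDomD η ν P (fun ξ => f ξ i))
    (hu : ∀ i, IsDelta η ν P (fun ξ z => u ξ z i) (fun ξ => f ξ i))
    (hs : ∀ i j, MemDomD η ν P (fun ξ => s ξ i j))
    (hdec : ∀ᵐ ω ∂P, symmetrize (bracket ν (u (η ω)) (addOp f (η ω))) =
        s (η ω) * (s (η ω)).transpose + ε ω) (l : Vec d) :
    ‖∫ ω, interp 1 (∑ i, l i * f (η ω) i) (tmul (s (η ω)) l) ∂P -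
      ∫ ω, interp 0 (∑ i, l i * f (η ω) i) (tmul (s (η ω)) l) ∂P‖ₑ ≤
    ENNReal.ofReal (∑ p : Fin d × Fin d, |l p.1 * l p.2|) *
        ∫⁻ ω, ENNReal.ofReal (matNorm (ε ω)) ∂P +
      ENNReal.ofReal (∑ p : Fin d × Fin d × Fin d, |l p.1 * (l p.2.1 * l p.2.2)|) *
        ∫⁻ ω, ENNReal.ofReal (ellTwo (bracketMat ν (u (η ω))
          (fun z => addOp s (η ω) z * (s (η ω)).transpose))) ∂P +
      3 * (‖l‖ₑ ^ 3 * (∫⁻ ω, ∫⁻ z, ‖u (η ω) z‖ₑ * ‖addOp f (η ω) z‖ₑ ^ 2 ∂ν ∂P +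
        ∫⁻ ω, ∫⁻ z, ‖u (η ω) z‖ₑ *
          ENNReal.ofReal (matNorm (addOp s (η ω) z)) ^ 2 ∂ν ∂P)) := by
  obtain ⟨hb2, hbD⟩ := memDomD_tmul hη hs l
  have hum : Measurable fun p : Ω × Z => u (η p.1) p.2 :=
    measurable_vec fun i => (hu i).measurable_comp hη
  have hfm : Measurable fun p : Ω × Z => addOp f (η p.1) p.2 :=
    hη.measurable_addOp (measurable_vec fun i => (hf i).measurable)
  have hslice_u : ∀ᵐ ω ∂P, ∀ i, MemLp (fun z => u (η ω) z i) 2 ν := by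
    rw [ae_all_iff]
    intro i
    have hm := (hu i).measurable_comp hη
    have := lintegral_lt_top_of_memLp_two (hu i).dom.memLp
    rw [lintegral_prod _ (hm.enorm.pow_const 2).aemeasurable] at this
    exact ae_memLp_two_slice hm this
  have hslice_f : ∀ᵐ ω ∂P, ∀ i, MemLp (fun z => addOp f (η ω) z i) 2 ν := by
    rw [ae_all_iff]
    exact fun i => ae_memLp_two_slice (hη.measurable_addOp (hf i).measurable) (hf i).deriv
  have hslice_s : ∀ᵐ ω ∂P, ∀ i j, MemLp (fun z => addOp s (η ω) z i j) 2 ν := by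
    rw [ae_all_iff]
    intro i
    rw [ae_all_iff]
    exact fun j => ae_memLp_two_slice (hη.measurable_addOp (hs i j).measurable) (hs i j).deriv
  -- The scalar bound is used with w = ⟨l, u⟩, A = ⟨l, F⟩ and b = Sᵀ l. Its three terms are
  -- estimated by the quantities of (ε), of (RS), and of (R₃) and (S₃) together.
  refine (enorm_integral_interp_sub_le hη (isDelta_sum (fun i => l i) hη hu)
    (memDomD_sum (fun i => l i) hη hf) (measurable_tmul (fun i j => (hs i j).measurable) l)
    hb2 hbD).trans (add_le_add (add_le_add ?_ ?_) ?_)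
  · rw [← lintegral_const_mul' _ _ ENNReal.ofReal_ne_top]
    refine lintegral_mono_ae ?_
    filter_upwards [hslice_u, hslice_f, hdec] with ω h1 h2 h3
    simp only [addOp_sum_mul]
    rw [integral_mul_eq_bracket h1 h2 l, ← sum_symmetrize, h3, norm_tmul_sq,
      ← Finset.sum_sub_distrib, ← ENNReal.ofReal_mul (Finset.sum_nonneg fun _ _ => abs_nonneg _),
      ← ofReal_norm]
    refine ENNReal.ofReal_le_ofReal ?_
    simp only [← mul_sub, Matrix.add_apply, add_sub_cancel_left, Real.norm_eq_abs]
    exact abs_sum_mul_le_ellTwo (fun p : Fin d × Fin d => l p.1 * l p.2) fun p => ε ω p.1 p.2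
  · rw [← lintegral_const_mul' _ _ ENNReal.ofReal_ne_top]
    refine lintegral_mono_ae ?_
    filter_upwards [hslice_u, hslice_s] with ω h1 h2
    simp only [addOp_tmul]
    rw [integral_mul_inner_eq_bracketMat h1 h2,
      ← ENNReal.ofReal_mul (Finset.sum_nonneg fun _ _ => abs_nonneg _), ← ofReal_norm]
    exact ENNReal.ofReal_le_ofReal (abs_sum_mul_le_ellTwo _ _)
  · gcongr
    have hm : Measurable fun p : Ω × Z => ‖u (η p.1) p.2‖ₑ * ‖addOp f (η p.1) p.2‖ₑ ^ 2 :=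
      hum.enorm.mul (hfm.enorm.pow_const 2)
    refine lintegral_lintegral_le_mul_add (by simp) hm fun ω z => ?_
    simp only [addOp_sum_mul, addOp_tmul]
    calc ‖∑ i, l i * u (η ω) z i‖ₑ * (‖∑ i, l i * addOp f (η ω) z i‖ₑ ^ 2 +
          ‖tmul (addOp s (η ω) z) l‖ₑ ^ 2)
        ≤ (‖l‖ₑ * ‖u (η ω) z‖ₑ) * ((‖l‖ₑ * ‖addOp f (η ω) z‖ₑ) ^ 2 +
          (‖l‖ₑ * ENNReal.ofReal (matNorm (addOp s (η ω) z))) ^ 2) := by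
          gcongr
          · exact enorm_sum_mul_le _ _
          · exact enorm_sum_mul_le _ _
          · exact enorm_tmul_le _ _
      _ = _ := by ring

end Functionals

/-! ### Conditional characteristic functions of the Gaussian mixture. -/

section CharacteristicFunctions

variable {Ω Z : Type*} [MeasurableSpace Ω] [MeasurableSpace Z] {P : Measure Ω}
  {ν : Measure Z} {η : Ω → Measure Z} {d : ℕ}

lemma inner_eq_sum_mul (x l : Vec d) : inner ℝ x l = ∑ i, l i * x i := by
  rw [PiLp.inner_apply]
  simp

lemma measurable_interp_comp {X : Type*} [MeasurableSpace X] {f : X → Vec d} {s : X → Mat d}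
    (hf : ∀ i, Measurable fun x => f x i) (hs : ∀ i j, Measurable fun x => s x i j)
    (r : ℝ) (l : Vec d) :
    Measurable fun x => interp r (∑ i, l i * f x i) (tmul (s x) l) := by
  have h1 : Measurable fun x => ∑ i, l i * f x i :=
    Finset.measurable_sum _ fun i _ => (hf i).const_mul _
  have h2 := measurable_tmul hs l
  unfold interp gaussWeight
  exact (Complex.measurable_exp.comp ((Complex.measurable_ofReal.comp
    (h1.const_mul r)).mul_const _)).mul (Complex.measurable_ofReal.comp
    (Real.measurable_exp.comp ((h2.norm.pow_const 2).const_mul _)))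

lemma interp_one (a : ℝ) (b : Vec d) : interp 1 a b = Complex.exp (a * Complex.I) := by
  simp [interp, gaussWeight]

lemma interp_zero (a : ℝ) (b : Vec d) : interp 0 a b = (Real.exp (-‖b‖ ^ 2 / 2) : ℝ) := by
  simp only [interp, gaussWeight]
  norm_num
  congr 1
  ring

/-- The characteristic function of a Gaussian mixture. -/
lemma integral_exp_inner_stdGaussian (A : Mat d) (l : Vec d) :
    ∫ x : Vec d, Complex.exp (((inner ℝ (WithLp.toLp 2 (A.mulVec x.ofLp) : Vec d) l : ℝ) : ℂ) *
      Complex.I) ∂stdGaussian (Vec d) = (Real.exp (-‖tmul A l‖ ^ 2 / 2) : ℝ) := by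
  have h : ∀ x : Vec d, inner ℝ (WithLp.toLp 2 (A.mulVec x.ofLp) : Vec d) l =
      inner ℝ x (tmul A l) := by
    intro x
    simp only [PiLp.inner_apply, tmul_apply, Matrix.mulVec, dotProduct, RCLike.inner_apply,
      conj_trivial, Finset.mul_sum, Finset.sum_mul]
    rw [Finset.sum_comm]
    exact Finset.sum_congr rfl fun i _ => Finset.sum_congr rfl fun j _ => by ring
  simp only [h]
  rw [← charFun_apply, charFun_stdGaussian]
  push_cast
  rfl

/-- Stable convergence of the conditional covariances gives convergence of the conditional
characteristic functions. -/
lemma tendsto_integral_interp_zero [IsProbabilityMeasure P] {s : ℕ → Measure Z → Mat d}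
    {S : Ω → Mat d} (f : ℕ → Measure Z → Vec d)
    (hC : StablyTendsto η P
      (fun n ω (i j : Fin d) => (s n (η ω) * (s n (η ω)).transpose) i j)
      P id (fun ω (i j : Fin d) => (S ω * (S ω).transpose) i j))
    {Y : Ω → ℝ} (hY : Measurable[sigmaAlg η] Y) (hYb : ∃ C : ℝ, ∀ᵐ ω ∂P, |Y ω| ≤ C)
    (l : Vec d) (t : ℝ) :
    Tendsto (fun n => ∫ ω, interp 0 (∑ i, l i * f n (η ω) i) (tmul (s n (η ω)) l) *
      Complex.exp ((t * Y ω : ℝ) * Complex.I) ∂P) atTop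
      (𝓝 (∫ ω, (Real.exp (-‖tmul (S ω) l‖ ^ 2 / 2) : ℝ) *
        Complex.exp ((t * Y ω : ℝ) * Complex.I) ∂P)) := by
  have h := hC.2 Y hY hYb
  -- The test function must be bounded for all matrices, so the quadratic form is truncated below at
  -- 0. On matrices of the form A Aᵀ the truncation has no effect.
  let g : (Fin d → Fin d → ℝ) × ℝ → ℂ := fun p =>
    (Real.exp (-(max (∑ q : Fin d × Fin d, (l q.1 * l q.2) * p.1 q.1 q.2) 0) / 2) : ℝ) *
      Complex.exp ((t * p.2 : ℝ) * Complex.I)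
  have hg : Continuous g := by fun_prop
  have hg1 : ∀ p, ‖g p‖ ≤ 1 := by
    intro p
    simp only [g]
    rw [norm_mul, Complex.norm_exp_ofReal_mul_I, mul_one, Complex.norm_real,
      Real.norm_of_nonneg (Real.exp_pos _).le, Real.exp_le_one_iff]
    have := le_max_right (∑ q : Fin d × Fin d, (l q.1 * l q.2) * p.1 q.1 q.2) 0
    linarith
  have hgA : ∀ (A : Mat d) (y : ℝ), g (fun i j => (A * A.transpose) i j, y) =
      (Real.exp (-‖tmul A l‖ ^ 2 / 2) : ℝ) * Complex.exp ((t * y : ℝ) * Complex.I) := by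
    intro A y
    simp only [g]
    rw [← norm_tmul_sq, max_eq_left (sq_nonneg _)]
  have key := (ProbabilityMeasure.tendsto_iff_forall_integral_rclike_tendsto ℂ).1 h.tendsto
    (BoundedContinuousFunction.ofNormedAddCommGroup g hg 1 hg1)
  simp only [BoundedContinuousFunction.coe_ofNormedAddCommGroup, ProbabilityMeasure.coe_mk] at key
  rw [integral_map h.aemeasurable_limit hg.aestronglyMeasurable] at key
  simp only [integral_map (h.forall_aemeasurable _) hg.aestronglyMeasurable] at key
  simp only [hgA, id] at key
  -- At r = 0 the interpolation ignores its first argument, so `f` is arbitrary here.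
  simpa only [interp_zero] using key

end CharacteristicFunctions
end PoissonSpace

/-! ### The main theorem. -/

open PoissonSpace
theorem mainTheorem5
    {Ω Z : Type*} [MeasurableSpace Ω] [MeasurableSpace Z]
    (P : Measure Ω) [IsProbabilityMeasure P]
    (ν : Measure Z) [SigmaFinite ν]
    (η : Ω → Measure Z) (hη : IsPoissonProcess η ν P)
    (d : ℕ)
    -- the functionals `F n = f n (η)`, the random functions `u n (η, z)`, the matrices `s n (η)`
    (f : ℕ → Measure Z → Vec d)
    (u : ℕ → Measure Z → Z → Vec d)
    (s : ℕ → Measure Z → Mat d)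
    (ε : ℕ → Ω → Mat d)
    (S : Ω → Mat d)
    (hS : ∀ i j, MemLp (fun ω => S ω i j) 2 P)
    (hf : ∀ n i, MemDomD η ν P (fun ξ => f n ξ i))
    (hu : ∀ n i, IsDelta η ν P (fun ξ z => u n ξ z i) (fun ξ => f n ξ i))
    (hs_meas : ∀ n i j, Measurable (fun ξ => s n ξ i j))
    (hs_dom : ∀ᶠ n in atTop, ∀ i j, MemDomD η ν P (fun ξ => s n ξ i j))
    -- asymptotic independence
    (hW : ∀ h : Z → Vec d, MemLp h 2 ν →
      Tendsto (fun n => ∫⁻ ω, ENNReal.ofReal (matNorm (bracket ν (u n (η ω)) h)) ∂P)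
        atTop (𝓝 0))
    (hR3 : Tendsto
      (fun n => ∫⁻ ω, ∫⁻ z, ‖u n (η ω) z‖ₑ * ‖addOp (f n) (η ω) z‖ₑ ^ 2 ∂ν ∂P) atTop (𝓝 0))
    -- the decomposition of the symmetrized bracket
    (hdec : ∀ᶠ n in atTop, ∀ᵐ ω ∂P,
      symmetrize (bracket ν (u n (η ω)) (addOp (f n) (η ω))) =
        s n (η ω) * (s n (η ω)).transpose + ε n ω)
    (hC : StablyTendsto η P
      (fun n ω (i j : Fin d) => (s n (η ω) * (s n (η ω)).transpose) i j)
      P id (fun ω (i j : Fin d) => (S ω * (S ω).transpose) i j))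
    (hε : Tendsto (fun n => ∫⁻ ω, ENNReal.ofReal (matNorm (ε n ω)) ∂P) atTop (𝓝 0))
    (hRS : Tendsto (fun n => ∫⁻ ω, ENNReal.ofReal (ellTwo (bracketMat ν (u n (η ω))
      (fun z => addOp (s n) (η ω) z * (s n (η ω)).transpose))) ∂P) atTop (𝓝 0))
    (hRh : ∀ h : Z → Vec d, MemLp h 2 ν → Tendsto
      (fun n => ∫⁻ ω, ∫⁻ z, ‖h z‖ₑ * ‖addOp (f n) (η ω) z‖ₑ ^ 2 ∂ν ∂P) atTop (𝓝 0))
    (hS3 : Tendsto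
      (fun n => ∫⁻ ω, ∫⁻ z, ‖u n (η ω) z‖ₑ *
        ENNReal.ofReal (matNorm (addOp (s n) (η ω) z)) ^ 2 ∂ν ∂P) atTop (𝓝 0))
    (hSh : ∀ h : Z → Vec d, MemLp h 2 ν → Tendsto
      (fun n => ∫⁻ ω, ∫⁻ z, ‖h z‖ₑ *
        ENNReal.ofReal (matNorm (addOp (s n) (η ω) z)) ^ 2 ∂ν ∂P) atTop (𝓝 0)) :
    -- `F n` converges stably to `S N`, where `N` is a standard Gaussian vector independent of
    -- everything defined on `Ω`: the second coordinate on `Ω × ℝ^d`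
    StablyTendsto η P (fun n ω => f n (η ω))
      (P.prod (stdGaussian (Vec d))) Prod.fst
      (fun p : Ω × Vec d => WithLp.toLp 2 ((S p.1).mulVec p.2.ofLp)) := by
  classical
  refine ⟨measurePreserving_fst, fun Y hY hYb => ?_⟩
  -- Writing Y = y(η) makes exp(itY) a functional of `η`, as the mixing theorem requires.
  obtain ⟨y, hy, rfl⟩ := hY.exists_eq_measurable_comp
  have hfm : ∀ n i, Measurable fun ξ => f n ξ i := fun n i => (hf n i).measurable
  have hSm : ∀ i j, AEMeasurable (fun p : Ω × Vec d => S p.1 i j) (P.prod (stdGaussian (Vec d))) :=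
    fun i j => (hS i j).1.aemeasurable.comp_quasiMeasurePreserving
      Measure.quasiMeasurePreserving_fst
  have hYm : AEMeasurable (y ∘ η) P := (hy.comp hη.measurable).aemeasurable
  have hlim : AEMeasurable (fun p : Ω × Vec d => (WithLp.toLp 2 ((S p.1).mulVec p.2.ofLp) : Vec d))
      (P.prod (stdGaussian (Vec d))) := by
    refine (WithLp.measurable_toLp 2 _).comp_aemeasurable (aemeasurable_pi_lambda _ fun i => ?_)
    simp only [Matrix.mulVec, dotProduct]
    refine Finset.aemeasurable_fun_sum _ fun j _ => (hSm i j).mul ?_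
    exact (by fun_prop : Measurable fun p : Ω × Vec d => p.2.ofLp j).aemeasurable
  have hYm' : AEMeasurable (fun p : Ω × Vec d => (y ∘ η) p.1) (P.prod (stdGaussian (Vec d))) :=
    hYm.comp_quasiMeasurePreserving Measure.quasiMeasurePreserving_fst
  refine tendstoInDistribution_prodMk_of_charFun
    (fun n => ((measurable_vec (hfm n)).comp hη.measurable).aemeasurable) hYm hlim hYm'
    fun l t => ?_
  let H : ℝ → ℕ → Measure Z → ℂ := fun r n ξ => interp r (∑ i, l i * f n ξ i) (tmul (s n ξ) l)
  let V : Measure Z → ℂ := fun ξ => Complex.exp ((t * y ξ : ℝ) * Complex.I)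
  have hHm : ∀ r n, Measurable (H r n) := fun r n =>
    measurable_interp_comp (hfm n) (hs_meas n) r l
  have hVm : Measurable V :=
    Complex.measurable_exp.comp ((Complex.measurable_ofReal.comp (hy.const_mul t)).mul_const _)
  have hV1 : ∀ ξ, ‖V ξ‖ ≤ 1 := fun ξ => (Complex.norm_exp_ofReal_mul_I _).le
  have hcov : ∀ r : ℝ, 0 ≤ r → r ≤ 1 → Tendsto (fun n => ∫ ω, H r n (η ω) * V (η ω) ∂P -
      (∫ ω, H r n (η ω) ∂P) * ∫ ω, V (η ω) ∂P) atTop (𝓝 0) := fun r h0 h1 =>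
    hη.tendsto_covariance (hHm r)
      (fun n ξ => norm_interp_le (by nlinarith) _ _)
      (fun A hA hνA => tendsto_lintegral_addOp_interp hη hfm hs_meas hRh hSh l h0 h1 hA hνA)
      hVm hV1
  -- This limit involves no test variable: the comparison of E H_1 with E H_0 is unconditional. It
  -- is used for large n only, where S_n lies in the domain of D and the decomposition holds.
  have hdiff : Tendsto (fun n => ∫ ω, H 1 n (η ω) ∂P - ∫ ω, H 0 n (η ω) ∂P) atTop (𝓝 0) := by
    rw [tendsto_zero_iff_enorm_tendsto_zero]
    have h1 := ENNReal.Tendsto.const_mul hε (Or.inr (ENNReal.ofReal_ne_top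
      (r := ∑ p : Fin d × Fin d, |l p.1 * l p.2|)))
    have h2 := ENNReal.Tendsto.const_mul hRS (Or.inr (ENNReal.ofReal_ne_top
      (r := ∑ p : Fin d × Fin d × Fin d, |l p.1 * (l p.2.1 * l p.2.2)|)))
    have h3 := ENNReal.Tendsto.const_mul (a := 3) (ENNReal.Tendsto.const_mul (a := ‖l‖ₑ ^ 3)
      (hR3.add hS3) (Or.inr (by simp))) (Or.inr (by simp))
    have h4 := (h1.add h2).add h3
    simp only [add_zero, mul_zero] at h4
    refine tendsto_of_tendsto_of_tendsto_of_le_of_le' tendsto_const_nhds h4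
      (Eventually.of_forall fun _ => zero_le) ?_
    filter_upwards [hs_dom, hdec] with n hn1 hn2
    exact enorm_integral_interp_sub_le_of_decomposition hη (hf n) (hu n) hn1 hn2 l
  have hzero := tendsto_integral_interp_zero f hC hY hYb l t
  -- E[H_1 V] = Cov(H_1, V) + (E H_1 - E H_0) E V - Cov(H_0, V) + E[H_0 V], and only the last term
  -- has a nontrivial limit.
  have htot := ((hcov 1 zero_le_one le_rfl).add (hdiff.mul_const (∫ ω, V (η ω) ∂P))).sub
    (hcov 0 le_rfl zero_le_one) |>.add hzero
  rw [zero_mul, add_zero, sub_zero, zero_add] at htot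
  -- By Fubini the Gaussian coordinate is integrated first, with `S` and `Y` frozen.
  have hrhs : ∫ p : Ω × Vec d, Complex.exp
      (((inner ℝ (WithLp.toLp 2 ((S p.1).mulVec p.2.ofLp) : Vec d) l +
        t * (y ∘ η) p.1 : ℝ) : ℂ) * Complex.I) ∂P.prod (stdGaussian (Vec d)) =
      ∫ ω, (Real.exp (-‖tmul (S ω) l‖ ^ 2 / 2) : ℝ) *
        Complex.exp ((t * (y ∘ η) ω : ℝ) * Complex.I) ∂P := by
    have hint : AEMeasurable (fun p : Ω × Vec d => Complex.exp
      (((inner ℝ (WithLp.toLp 2 ((S p.1).mulVec p.2.ofLp) : Vec d) l +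
        t * (y ∘ η) p.1 : ℝ) : ℂ) * Complex.I)) (P.prod (stdGaussian (Vec d))) :=
      Complex.measurable_exp.comp_aemeasurable ((Complex.measurable_ofReal.comp_aemeasurable
        ((hlim.inner aemeasurable_const).add (hYm'.const_mul t))).mul_const _)
    rw [integral_prod _ (Integrable.of_bound hint.aestronglyMeasurable 1
      (Eventually.of_forall fun p => (Complex.norm_exp_ofReal_mul_I _).le))]
    refine integral_congr_ae (Eventually.of_forall fun ω => ?_)
    simp only [Complex.ofReal_add, add_mul, Complex.exp_add]
    rw [integral_mul_const, integral_exp_inner_stdGaussian]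
  rw [hrhs]
  refine htot.congr fun n => ?_
  have e : ∀ ω, Complex.exp (((inner ℝ (f n (η ω)) l + t * (y ∘ η) ω : ℝ) : ℂ) * Complex.I) =
      H 1 n (η ω) * V (η ω) := by
    intro ω
    simp only [H, V, interp_one, inner_eq_sum_mul, ← Complex.exp_add, ← add_mul,
      Complex.ofReal_add, Function.comp_apply]
  simp only [e]
  simp only [H, V, Function.comp_apply]
  ring
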